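/- **Setting.** Let $\mathcal X$ be a finite population and $\mathcal O$ a finite non-empty set of outcomes, $\ell=|\mathcal O|$. Let $(i,o^*_i)$ be a random individual-outcome pair with an unknown law $D$ on $\mathcal X\times\mathcal O$. A predictor is a map $\tilde p:\mathcal X\to\Delta\mathcal O$ into the probability distributions on $\mathcal O$; given $i$, the modeled outcome $\tilde o_i$ is drawn from $\tilde p_i$. For $\mathcal C\subseteq\{0,1\}^{\mathcal X}$, the predictor $\tilde p$ is $(\mathcal C,\varepsilon)$-multi-calibrated if for every $c\in\mathcal C$ the laws of $(c_i,\tilde o_i,\tilde p_i)$ and $(c_i,o^*_i,\tilde p_i)$ have statistical distance $\max_A|\Pr[\cdot\in A]-\Pr[\cdot\in A]|$ at most $\varepsilon$. $\mathsf{VC}(\mathcal C)$ is the Vapnik–Chervonenkis dimension. **Weak agnostic learners.** A (randomized) learner $\mathsf{WAL}_{\mathcal C}$ takes $\varepsilon>0$ and a sequence of labeled data in $\mathcal X\times[-1,1]$ and outputs some $c\in\mathcal C$ or $\bot$. It is a weak agnostic learner with failure probability $\beta$ on $m$ samples from a discrete law of $(x,y)\in\mathcal X\times[-1,1]$ if,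 run on $m$ i.i.d. copies of $(x,y)$: (i) if some $c\in\mathcal C$ has $\mathbb E[c_xy]>\varepsilon$, then with probability at least $1-\beta$ it outputs $c'\in\mathcal C$ with $\mathbb E[c'_xy]>\varepsilon/2$; (ii) if all $c\in\mathcal C$ have $\mathbb E[c_xy]\le\varepsilon$, then with probability at least $1-\beta$ it outputs $\bot$ or some $c'\in\mathcal C$ with $\mathbb E[c'_xy]>\varepsilon/2$. Call it $K$-standard for $\mathcal C$ if this holds for all such laws, all $\varepsilon,\beta\in(0,1)$ and all $m\ge K\,(\mathsf{VC}(\mathcal C)\log(2/\varepsilon)+\log(1/\beta))/\varepsilon^2$. **Random-sign algorithms.** Fix a finite grid $\mathcal G\subset\Delta\mathcal O$ and a discretization that sends each $f\in\Delta\mathcal O$ to a nearest point $\hat f\in\mathcal G$ in the metric $\frac12\sum_o|f(o)-g(o)|$. A random-sign algorithm may adaptively use internal randomness, draw fresh copies of $(i,o^*_i)$, output a predictor, and perform tests. A test is given an accuracy $\theta$, a predictor $\tilde p$ and a number $T$; it draws $E\subseteq\{1\}\times\mathcal O\times\mathcal G$ uniformly at random and $T$ fresh copies of $(i,o^*_i)$,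 labels each of them by $y=\mathbf 1[(1,\tilde o_i,\hat p_i)\in E]-\mathbf 1[(1,o^*_i,\hat p_i)\in E]$ with $\tilde o_i$ freshly drawn from $\tilde p_i$, calls the learner with accuracy $\theta$ on the $T$ data $(i,y)$, and returns $E$ and the learner's answer to the algorithm. The algorithm has no other access to $\mathcal C$. It uses at most $n$ samples if in every run it draws at most $n$ copies of $(i,o^*_i)$, those used in tests included. **Theorem.** 1. There is an absolute constant $K>0$ such that for every finite $\mathcal X$, every $\mathcal C\subseteq\{0,1\}^{\mathcal X}$ with $\mathsf{VC}(\mathcal C)\ge1$ has a $K$-standard weak agnostic learner. 2. For every $K>0$ there is a constant $c>0$, depending only on $K$, such that for all finite $\mathcal X$, all finite non-empty $\mathcal O$ with $\ell=|\mathcal O|$, all integers $d\ge1$ and all $\varepsilon>0$ there are a finite grid $\mathcal G\subset\Delta\mathcal O$ with a discretization and a random-sign algorithm using at most $$n\le\left(\frac{c\,\ell}{\varepsilon}\right)^{2\ell+c}d$$ samples such that, for every $\mathcal C\subseteq\{0,1\}^{\mathcal X}$ with $\mathsf{VC}(\mathcal C)=d$, every $K$-standard weak agnostic learner $\mathsf{WAL}_{\mathcal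 C}$ for $\mathcal C$ and every law $D$ of $(i,o^*_i)$, the algorithm run with $\mathsf{WAL}_{\mathcal C}$ outputs a $(\mathcal C,\varepsilon)$-multi-calibrated predictor with probability at least $9/10$. -/

import Mathlib

open scoped ENNReal

namespace MultiCal

universe u v w

/-! ### Probability on discrete spaces -/

/-- The probability of the event `A` under `μ`, as a real number. -/
noncomputable def pr {Z : Type w} (μ : PMF Z) (A : Set Z) : ℝ := (μ.toOuterMeasure A).toReal

/-- Statistical distance: the largest difference of probabilities over all events. -/
noncomputable def statDist {Z : Type w} (μ ν : PMF Z) : ℝ := ⨆ A : Set Z, |pr μ A - pr ν A|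

/-- The law of a list of `m` independent draws from `P`. -/
noncomputable def iidList {Z : Type w} (P : PMF Z) : ℕ → PMF (List Z)
  | 0 => PMF.pure []
  | m + 1 => P.bind fun z => (iidList P m).map fun l => z :: l

/-! ### Predictors and multi-calibration

`X` is the population and `O` the set of outcomes, both finite. A probability distribution on `O`
is a `PMF O`, a predictor is a function `X → PMF O`, and `D : PMF (X × O)` is the joint law of an
individual and its true outcome. -/

/-- The joint law of the individual `i` and its modeled outcome, drawn from `p i`. -/
noncomputable def modeled {X : Type u} {O : Type v} (D : PMF (X × O)) (p : X → PMF O) :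
    PMF (X × O) :=
  D.bind fun z => (p z.1).map fun o => (z.1, o)

/-- The law of `(c i, o, p i)` when `(i, o)` has law `D`. -/
noncomputable def view {X : Type u} {O : Type v} (D : PMF (X × O)) (c : X → Bool)
    (p : X → PMF O) : PMF (Bool × O × PMF O) :=
  D.map fun z => (c z.1, z.2, p z.1)

/-- `(C, ε)`-multi-calibration of the predictor `p` with respect to `D`. -/
def MultiCalibrated {X : Type u} {O : Type v} (C : Finset (X → Bool)) (ε : ℝ)
    (D : PMF (X × O)) (p : X → PMF O) : Prop :=
  ∀ c ∈ C, statDist (view (modeled D p) c p) (view D c p) ≤ ε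

open Classical in
/-- The Vapnik–Chervonenkis dimension of a class of `{0, 1}`-valued functions: that of the family
of their supports. -/
noncomputable def vc {X : Type u} [Fintype X] (C : Finset (X → Bool)) : ℕ :=
  (C.image fun c => Finset.univ.filter fun x => c x = true).vcDim

/-! ### Weak agnostic learners -/

/-- The type of a (randomized) learner: given an accuracy and a list of labeled data, it returns a
function or the symbol `⊥`, written `none`. -/
abbrev Learner (X : Type u) := ℝ → List (X × ℝ) → PMF (Option (X → Bool))

/-- The correlation `𝔼[c x * y]`, where `(x, y)` has law `P`. -/
noncomputable def corr {X : Type u} (P : PMF (X × ℝ)) (c : X → Bool) : ℝ :=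
  ∑' z : X × ℝ, (P z).toReal * (if c z.1 = true then z.2 else 0)

/-- The law of the output of `W` on accuracy `ε` and `m` independent draws from `P`. -/
noncomputable def learn {X : Type u} (W : Learner X) (ε : ℝ) (P : PMF (X × ℝ)) (m : ℕ) :
    PMF (Option (X → Bool)) :=
  (iidList P m).bind fun data => W ε data

/-- Functions in `C` whose correlation exceeds `ε / 2`. -/
def Found {X : Type u} (C : Finset (X → Bool)) (P : PMF (X × ℝ)) (ε : ℝ) :
    Set (Option (X → Bool)) :=
  {r | ∃ c ∈ C, r = some c ∧ ε / 2 < corr P c}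

/-- `W`, run with accuracy `ε` on `m` independent draws from `P`, satisfies the two guarantees of a
weak agnostic learner for `C` with failure probability `β`. -/
def WeakAgnostic {X : Type u} (W : Learner X) (C : Finset (X → Bool)) (P : PMF (X × ℝ))
    (ε β : ℝ) (m : ℕ) : Prop :=
  ((∃ c ∈ C, ε < corr P c) → 1 - β ≤ pr (learn W ε P m) (Found C P ε)) ∧
  ((∀ c ∈ C, corr P c ≤ ε) → 1 - β ≤ pr (learn W ε P m) (Found C P ε ∪ {none}))

/-- `W` is a weak agnostic learner for `C` with the standard sample complexity: it only ever
returns functions in `C` or `⊥`, and on every distribution of data with labels in `[-1, 1]` its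
failure probability is at most `β` as soon as it is given
`K * (VC(C) * log (2 / ε) + log (1 / β)) / ε ^ 2` samples. -/
def StandardLearner {X : Type u} [Fintype X] (K : ℝ) (C : Finset (X → Bool))
    (W : Learner X) : Prop :=
  (∀ ε data c, some c ∈ (W ε data).support → c ∈ C) ∧
  ∀ P : PMF (X × ℝ), (∀ z ∈ P.support, z.2 ∈ Set.Icc (-1 : ℝ) 1) →
    ∀ (ε β : ℝ) (m : ℕ), 0 < ε → ε < 1 → 0 < β → β < 1 →
      K * (vc C * Real.log (2 / ε) + Real.log (1 / β)) / ε ^ 2 ≤ m →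
      WeakAgnostic W C P ε β m

/-! ### Algorithms -/

/-- `round` is a discretization to the finite grid `G`: it sends each distribution on `O` to a
nearest point of `G`, in the metric `½ ∑ o, |f o - g o|`. -/
def IsDiscretization {O : Type v} [Fintype O] (G : Finset (PMF O)) (round : PMF O → G) : Prop :=
  ∀ f : PMF O, ∀ g ∈ G,
    (1 / 2 : ℝ) * ∑ o, |(f o).toReal - ((round f : PMF O) o).toReal| ≤
      (1 / 2 : ℝ) * ∑ o, |(f o).toReal - (g o).toReal|

/-- Randomized, adaptive algorithms that draw fresh individual-outcome pairs and have access to a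
weak agnostic learner only through tests with random signs. Such an algorithm is a well-founded
decision tree. Its nodes do one of the following:
* `output p`: stop and output the predictor `p`;
* `draw μ k`: draw internal randomness `a` from `μ` and continue with `k a`;
* `sample k`: draw a fresh pair `z` from the unknown distribution and continue with `k z`;
* `test θ p T k`: choose a uniformly random `E ⊆ {1} × O × G` (the component `1` is left out of the
  notation), draw `T` fresh pairs, label them by means of `E` and the predictor `p`, call the
  learner with accuracy `θ` on these data, and continue with `k E r`, where `r` is its answer.

The class `C` does not occur: it can influence a run only through the answers of the learner. -/
inductive Algorithm (X : Type u) (O : Type v) (G : Finset (PMF O)) : Type (max u v)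
  | output (p : X → PMF O) : Algorithm X O G
  | draw (μ : PMF ℕ) (k : ℕ → Algorithm X O G) : Algorithm X O G
  | sample (k : X × O → Algorithm X O G) : Algorithm X O G
  | test (θ : ℝ) (p : X → PMF O) (T : ℕ)
      (k : Finset (O × G) → Option (X → Bool) → Algorithm X O G) : Algorithm X O G

open Classical in
/-- The label `𝟙[(1, o', v) ∈ E] - 𝟙[(1, o, v) ∈ E]`, where `o'` is the modeled outcome, `o` the
true one and `v` the rounded prediction. -/
noncomputable def label {O : Type v} {G : Finset (PMF O)} (E : Finset (O × G)) (o' o : O)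
    (v : G) : ℝ :=
  (if (o', v) ∈ E then 1 else 0) - (if (o, v) ∈ E then 1 else 0)

/-- The law of one labeled datum `(i, label)`: `(i, o)` is drawn from `D`, then `o'` from `p i`. -/
noncomputable def labeled {X : Type u} {O : Type v} {G : Finset (PMF O)} (round : PMF O → G)
    (D : PMF (X × O)) (p : X → PMF O) (E : Finset (O × G)) : PMF (X × ℝ) :=
  D.bind fun z => (p z.1).map fun o' => (z.1, label E o' z.2 (round (p z.1)))

/-- The law of the predictor that an algorithm outputs, when the pairs are drawn independently from
`D`, the learner is `W`, and predictions are discretized by `round`. -/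
noncomputable def Algorithm.run {X : Type u} {O : Type v} [Fintype O] {G : Finset (PMF O)}
    (round : PMF O → G) (W : Learner X) (D : PMF (X × O)) :
    Algorithm X O G → PMF (X → PMF O)
  | .output p => PMF.pure p
  | .draw μ k => μ.bind fun a => (k a).run round W D
  | .sample k => D.bind fun z => (k z).run round W D
  | .test θ p T k =>
      (PMF.uniformOfFintype (Finset (O × G))).bind fun E =>
        (learn W θ (labeled round D p E) T).bind fun r => (k E r).run round W D

/-- On every path, the algorithm draws at most `n` individual-outcome pairs, those passed to the
learner included. -/
def Algorithm.UsesAtMost {X : Type u} {O : Type v} {G : Finset (PMF O)} :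
    Algorithm X O G → ℕ → Prop
  | .output _, _ => True
  | .draw _ k, n => ∀ a, (k a).UsesAtMost n
  | .sample k, n => 1 ≤ n ∧ ∀ z, (k z).UsesAtMost (n - 1)
  | .test _ _ T k, n => T ≤ n ∧ ∀ E r, (k E r).UsesAtMost (n - T)

end MultiCal

/-! A standard learner exists because empirical correlations converge uniformly over `C`.
Symmetrization with a ghost sample and the Sauer-Shelah bound on traces give the deviation estimate
(`one_sided_deviation`, `correlation_deviation`). Thresholding empirical correlations at `3 / 4 *
ε`, midway between `ε / 2` and `ε`, then meets both guarantees.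

For multi-calibration, attach to a predictor and a function `c` its vector of discrepancies `disc`,
indexed by the `N = |O × G|` pairs of an outcome and a grid point. Its coordinates sum to zero, and
the correlation of `c` with the labels of a test `E` is the sum of the coordinates in `E`
(`corr_labeled`, `sum_disc_eq`). If the rounded predictor is not multi-calibrated, this vector has
`ℓ¹` norm above `ε / 8` for some `c ∈ C` or for the constant function `1`, which is needed for
events among individuals with `c = 0` (`multiCalibrated_of_disc_le`). By a second and fourth moment
argument a random `E` then has sum above `θ = ε / (32 * √N)` with probability at least `1 / 10`
(`two_pow_le_card_large_sum`). The constant `1` need not lie in `C`, so the algorithm estimates its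
correlation from its own samples.

A function with correlation above `θ / 2` yields a multiplicative-weights update that lowers the
logarithmic loss by at least `θ ^ 2 / 16` (`logLoss_update_le`). The loss starts at `log ℓ` and
stays nonnegative, so the expected number of times at which the predictor is bad is of order `ℓ / θ
^ 2`, up to the cost of failed estimates. The algorithm does not recognize a good predictor: it
stops at a uniformly random time below `B`, and the expected fraction of bad times bounds its
failure probability (`sum_bad_le`, `boostRandomly_spec`). As only expectations are used, a failure
probability `β` of order `θ` per call is enough.

Both the number of rounds and the samples per round carry a factor `1 / θ ^ 2`, of order `N / ε ^
2`, and `N ≤ ℓ * (6 * ℓ / ε) ^ ℓ`. This explains the exponent `2 * ℓ + O(1)` (`sample_bound`). -/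

open scoped ENNReal

namespace MultiCal

universe u v w

/-! ### Expectations under discrete laws. -/

section Expectation

variable {Z : Type u} {Y : Type v}

/-- The expectation of a nonnegative extended-real function under a discrete law. -/
noncomputable def ex (μ : PMF Z) (f : Z → ℝ≥0∞) : ℝ≥0∞ := ∑' z, μ z * f z

/-- The expectation of a real function under a discrete law. -/
noncomputable def mean (μ : PMF Z) (f : Z → ℝ) : ℝ := ∑' z, (μ z).toReal * f z

theorem ex_pure (a : Z) (f : Z → ℝ≥0∞) : ex (PMF.pure a) f = f a := by
  unfold ex
  rw [tsum_eq_single a (fun b hb => by simp [PMF.pure_apply, hb])]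
  simp

theorem ex_bind (μ : PMF Z) (k : Z → PMF Y) (f : Y → ℝ≥0∞) :
    ex (μ.bind k) f = ex μ fun z => ex (k z) f := by
  unfold ex
  simp only [PMF.bind_apply, ← ENNReal.tsum_mul_right, ← ENNReal.tsum_mul_left]
  rw [ENNReal.tsum_comm]
  simp only [mul_assoc]

theorem ex_map (μ : PMF Z) (g : Z → Y) (f : Y → ℝ≥0∞) :
    ex (μ.map g) f = ex μ fun z => f (g z) := by
  rw [← PMF.bind_pure_comp, ex_bind]
  simp [ex_pure]

theorem ex_mono_of_support {μ : PMF Z} {f g : Z → ℝ≥0∞} (h : ∀ z ∈ μ.support, f z ≤ g z) :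
    ex μ f ≤ ex μ g := by
  refine ENNReal.tsum_le_tsum fun z => ?_
  by_cases hz : z ∈ μ.support
  · exact mul_le_mul_right (h z hz) _
  · rw [(PMF.apply_eq_zero_iff μ z).2 hz]; simp

theorem ex_mono {μ : PMF Z} {f g : Z → ℝ≥0∞} (h : ∀ z, f z ≤ g z) : ex μ f ≤ ex μ g :=
  ex_mono_of_support fun z _ => h z

theorem ex_const (μ : PMF Z) (c : ℝ≥0∞) : ex μ (fun _ => c) = c := by
  unfold ex
  rw [ENNReal.tsum_mul_right, PMF.tsum_coe, one_mul]

theorem ex_add (μ : PMF Z) (f g : Z → ℝ≥0∞) : ex μ (fun z => f z + g z) = ex μ f + ex μ g := by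
  unfold ex
  simp only [mul_add]
  exact ENNReal.tsum_add

theorem ex_mul_left (μ : PMF Z) (c : ℝ≥0∞) (f : Z → ℝ≥0∞) :
    ex μ (fun z => c * f z) = c * ex μ f := by
  unfold ex
  rw [← ENNReal.tsum_mul_left]
  exact tsum_congr fun z => mul_left_comm _ _ _

theorem ex_mul_right (μ : PMF Z) (c : ℝ≥0∞) (f : Z → ℝ≥0∞) :
    ex μ (fun z => f z * c) = ex μ f * c := by
  simp only [mul_comm _ c, ex_mul_left]

theorem ex_finset_sum {ι : Type w} (μ : PMF Z) (s : Finset ι) (f : ι → Z → ℝ≥0∞) :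
    ex μ (fun z => ∑ i ∈ s, f i z) = ∑ i ∈ s, ex μ (f i) := by
  classical
  induction s using Finset.induction_on with
  | empty => simp [ex_const]
  | insert a s ha ih => simp only [Finset.sum_insert ha, ex_add, ih]

theorem ex_comm (μ : PMF Z) (ν : PMF Y) (f : Z → Y → ℝ≥0∞) :
    (ex μ fun z => ex ν fun y => f z y) = ex ν fun y => ex μ fun z => f z y := by
  unfold ex
  simp only [← ENNReal.tsum_mul_left]
  rw [ENNReal.tsum_comm]
  exact tsum_congr fun y => tsum_congr fun z => mul_left_comm _ _ _

theorem toOuterMeasure_eq_ex (μ : PMF Z) (A : Set Z) :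
    μ.toOuterMeasure A = ex μ (A.indicator 1) := by
  rw [PMF.toOuterMeasure_apply, ex]
  refine tsum_congr fun z => ?_
  by_cases hz : z ∈ A <;> simp [hz]

theorem toOuterMeasure_add_compl (μ : PMF Z) (A : Set Z) :
    μ.toOuterMeasure A + μ.toOuterMeasure Aᶜ = 1 := by
  rw [toOuterMeasure_eq_ex, toOuterMeasure_eq_ex, ← ex_add, ← ex_const μ 1]
  congr 1
  funext z
  by_cases hz : z ∈ A <;> simp [hz]

theorem toOuterMeasure_le_one (μ : PMF Z) (A : Set Z) : μ.toOuterMeasure A ≤ 1 := by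
  rw [← toOuterMeasure_add_compl μ A]; exact le_self_add

theorem pr_le_one (μ : PMF Z) (A : Set Z) : pr μ A ≤ 1 :=
  ENNReal.toReal_le_of_le_ofReal zero_le_one (by simpa using toOuterMeasure_le_one μ A)

theorem one_sub_le_pr_iff {μ : PMF Z} {A : Set Z} {β : ℝ} (hβ : 0 ≤ β) :
    1 - β ≤ pr μ A ↔ μ.toOuterMeasure Aᶜ ≤ ENNReal.ofReal β := by
  have h := toOuterMeasure_add_compl μ A
  have hA : μ.toOuterMeasure A ≠ ∞ :=
    ne_top_of_le_ne_top ENNReal.one_ne_top (toOuterMeasure_le_one μ A)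
  have hB : μ.toOuterMeasure Aᶜ ≠ ∞ :=
    ne_top_of_le_ne_top ENNReal.one_ne_top (toOuterMeasure_le_one μ _)
  have h' := congrArg ENNReal.toReal h
  rw [ENNReal.toReal_add hA hB, ENNReal.toReal_one] at h'
  rw [ENNReal.le_ofReal_iff_toReal_le hB hβ, pr]
  constructor <;> intro <;> linarith

theorem toOuterMeasure_bind (μ : PMF Z) (k : Z → PMF Y) (A : Set Y) :
    (μ.bind k).toOuterMeasure A = ex μ fun z => (k z).toOuterMeasure A := by
  simp only [toOuterMeasure_eq_ex, ex_bind]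

theorem summable_toReal (μ : PMF Z) : Summable fun z => (μ z).toReal :=
  ENNReal.summable_toReal μ.tsum_coe_ne_top

theorem tsum_toReal (μ : PMF Z) : ∑' z, (μ z).toReal = 1 := by
  rw [← ENNReal.tsum_toReal_eq (fun z => μ.apply_ne_top z), PMF.tsum_coe, ENNReal.toReal_one]

theorem summable_mean {μ : PMF Z} {f : Z → ℝ} {M : ℝ} (h : ∀ z ∈ μ.support, |f z| ≤ M) :
    Summable fun z => (μ z).toReal * f z := by
  refine Summable.of_norm_bounded (g := fun z => (μ z).toReal * M)
    ((summable_toReal μ).mul_right M) fun z => ?_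
  rw [norm_mul, Real.norm_of_nonneg ENNReal.toReal_nonneg, Real.norm_eq_abs]
  by_cases hz : z ∈ μ.support
  · exact mul_le_mul_of_nonneg_left (h z hz) ENNReal.toReal_nonneg
  · simp [(PMF.apply_eq_zero_iff μ z).2 hz]

theorem ex_ofReal {μ : PMF Z} {f : Z → ℝ} {M : ℝ} (h0 : ∀ z ∈ μ.support, 0 ≤ f z)
    (h : ∀ z ∈ μ.support, f z ≤ M) :
    ex μ (fun z => ENNReal.ofReal (f z)) = ENNReal.ofReal (mean μ f) := by
  have hnn : ∀ z, 0 ≤ (μ z).toReal * f z := fun z => by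
    by_cases hz : z ∈ μ.support
    · exact mul_nonneg ENNReal.toReal_nonneg (h0 z hz)
    · simp [(PMF.apply_eq_zero_iff μ z).2 hz]
  rw [mean, ENNReal.ofReal_tsum_of_nonneg hnn
    (summable_mean (M := M) fun z hz => by rw [abs_of_nonneg (h0 z hz)]; exact h z hz)]
  refine tsum_congr fun z => ?_
  rw [ENNReal.ofReal_mul ENNReal.toReal_nonneg, ENNReal.ofReal_toReal (μ.apply_ne_top z)]

theorem mean_add_const {μ : PMF Z} {f : Z → ℝ} {M : ℝ} (h : ∀ z ∈ μ.support, |f z| ≤ M)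
    (c : ℝ) : mean μ (fun z => f z + c) = mean μ f + c := by
  unfold mean
  simp only [mul_add]
  rw [(summable_mean h).tsum_add ((summable_toReal μ).mul_right c), tsum_mul_right, tsum_toReal,
    one_mul]

theorem mean_neg (μ : PMF Z) (f : Z → ℝ) : mean μ (fun z => -f z) = -mean μ f := by
  unfold mean
  simp only [mul_neg, tsum_neg]

theorem mean_const_mul (μ : PMF Z) (c : ℝ) (f : Z → ℝ) :
    mean μ (fun z => c * f z) = c * mean μ f := by
  unfold mean
  simp only [mul_left_comm _ c, tsum_mul_left]

theorem mean_mono {μ : PMF Z} {f g : Z → ℝ} {M : ℝ} (hf : ∀ z ∈ μ.support, |f z| ≤ M)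
    (hg : ∀ z ∈ μ.support, |g z| ≤ M) (h : ∀ z ∈ μ.support, f z ≤ g z) : mean μ f ≤ mean μ g := by
  refine Summable.tsum_le_tsum (fun z => ?_) (summable_mean hf) (summable_mean hg)
  by_cases hz : z ∈ μ.support
  · exact mul_le_mul_of_nonneg_left (h z hz) ENNReal.toReal_nonneg
  · simp [(PMF.apply_eq_zero_iff μ z).2 hz]

theorem mean_const (μ : PMF Z) (c : ℝ) : mean μ (fun _ => c) = c := by
  unfold mean
  rw [tsum_mul_right, tsum_toReal, one_mul]

theorem abs_mean_le {μ : PMF Z} {f : Z → ℝ} {M : ℝ} (h : ∀ z ∈ μ.support, |f z| ≤ M) :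
    |mean μ f| ≤ M := by
  have hM : ∀ z ∈ μ.support, |M| ≤ M := fun z hz =>
    (abs_of_nonneg ((abs_nonneg _).trans (h z hz))).le
  have hM' : ∀ z ∈ μ.support, |-M| ≤ M := fun z hz => by rw [abs_neg]; exact hM z hz
  rw [abs_le]
  constructor
  · rw [← mean_const μ (-M)]
    exact mean_mono hM' h fun z hz => (abs_le.1 (h z hz)).1
  · rw [← mean_const μ M]
    exact mean_mono h hM fun z hz => (abs_le.1 (h z hz)).2

/-- Expectations of functions with values in `[-1, 1]`, expressed by nonnegative ones. -/
theorem mean_eq_toReal_sub {μ : PMF Z} {f : Z → ℝ} (h : ∀ z ∈ μ.support, |f z| ≤ 1) :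
    mean μ f = (ex μ fun z => ENNReal.ofReal (f z + 1)).toReal - 1 := by
  rw [ex_ofReal (M := 2) (fun z hz => by linarith [(abs_le.1 (h z hz)).1])
    (fun z hz => by linarith [(abs_le.1 (h z hz)).2]), mean_add_const h, ENNReal.toReal_ofReal]
  · ring
  · linarith [(abs_le.1 (abs_mean_le h)).1]

theorem ex_congr_of_support {μ : PMF Z} {f g : Z → ℝ≥0∞} (h : ∀ z ∈ μ.support, f z = g z) :
    ex μ f = ex μ g :=
  le_antisymm (ex_mono_of_support fun z hz => (h z hz).le)
    (ex_mono_of_support fun z hz => (h z hz).ge)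

/-- Adding `1` makes the function nonnegative, which reduces the claim to `ex_bind`, where no
summability is required. -/
theorem mean_bind {μ : PMF Z} {k : Z → PMF Y} {f : Y → ℝ}
    (h : ∀ z ∈ μ.support, ∀ y ∈ (k z).support, |f y| ≤ 1) :
    mean (μ.bind k) f = mean μ fun z => mean (k z) f := by
  have h' : ∀ z ∈ μ.support, |mean (k z) f| ≤ 1 := fun z hz => abs_mean_le (h z hz)
  have hb : ∀ y ∈ (μ.bind k).support, |f y| ≤ 1 := fun y hy => by
    obtain ⟨z, hz, hy⟩ := (PMF.mem_support_bind_iff _ _ _).1 hy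
    exact h z hz y hy
  rw [mean_eq_toReal_sub hb, mean_eq_toReal_sub h', ex_bind]
  congr 2
  refine ex_congr_of_support fun z hz => ?_
  rw [ex_ofReal (M := 2) (fun y hy => by linarith [(abs_le.1 (h z hz y hy)).1])
    (fun y hy => by linarith [(abs_le.1 (h z hz y hy)).2]), mean_add_const (h z hz)]

theorem mean_map {μ : PMF Z} {g : Z → Y} {f : Y → ℝ} (h : ∀ z ∈ μ.support, |f (g z)| ≤ 1) :
    mean (μ.map g) f = mean μ fun z => f (g z) := by
  have hb : ∀ y ∈ (μ.map g).support, |f y| ≤ 1 := fun y hy => by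
    obtain ⟨z, hz, rfl⟩ := (PMF.mem_support_map_iff _ _ _).1 hy
    exact h z hz
  rw [mean_eq_toReal_sub hb, mean_eq_toReal_sub h, ex_map]

theorem mean_fintype [Fintype Z] (μ : PMF Z) (f : Z → ℝ) :
    mean μ f = ∑ z, (μ z).toReal * f z := tsum_fintype _

theorem sum_toReal [Fintype Z] (μ : PMF Z) : ∑ z, (μ z).toReal = 1 := by
  rw [← tsum_toReal μ, tsum_fintype]

theorem pr_eq_mean (μ : PMF Z) (A : Set Z) : pr μ A = mean μ (A.indicator 1) := by
  have h0 : ∀ z, 0 ≤ A.indicator (1 : Z → ℝ) z := fun z => Set.indicator_nonneg (by simp) z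
  have h1 : ∀ z, A.indicator (1 : Z → ℝ) z ≤ 1 := fun z => Set.indicator_le_self' (by simp) z
  have e : A.indicator (1 : Z → ℝ≥0∞) = fun z => ENNReal.ofReal (A.indicator (1 : Z → ℝ) z) := by
    funext z
    by_cases hz : z ∈ A <;> simp [hz]
  rw [pr, toOuterMeasure_eq_ex, e, ex_ofReal (fun z _ => h0 z) (fun z _ => h1 z),
    ENNReal.toReal_ofReal]
  exact tsum_nonneg fun z => mul_nonneg ENNReal.toReal_nonneg (h0 z)

/-- Jensen's inequality for the exponential function. -/
theorem ofReal_exp_mean_le {μ : PMF Z} {f : Z → ℝ} (h : ∀ z ∈ μ.support, |f z| ≤ 1) (a : ℝ) :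
    ENNReal.ofReal (Real.exp (a * mean μ f)) ≤
      ex μ fun z => ENNReal.ofReal (Real.exp (a * f z)) := by
  have hb : ∀ z ∈ μ.support, |a * f z| ≤ |a| := fun z hz => by
    rw [abs_mul]; exact mul_le_of_le_one_right (abs_nonneg a) (h z hz)
  have hE : ∀ z ∈ μ.support, Real.exp (a * f z) ≤ Real.exp |a| := fun z hz =>
    Real.exp_le_exp.2 ((le_abs_self _).trans (hb z hz))
  rw [ex_ofReal (fun z _ => (Real.exp_pos _).le) hE]
  refine ENNReal.ofReal_le_ofReal ?_
  set c := a * mean μ f with hc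
  -- The integrand is the tangent line of the exponential at `c`, evaluated at `a * f z`; it lies
  -- below the exponential.
  have key : mean μ (fun z => Real.exp c * (a * f z + (1 - c))) = Real.exp c := by
    rw [mean_const_mul, mean_add_const hb, mean_const_mul, ← hc]; ring
  rw [← key]
  refine mean_mono (M := max (Real.exp |a|) (Real.exp c * (|a| + |1 - c|))) (fun z hz => ?_)
    (fun z hz => ?_) (fun z _ => ?_)
  · refine le_max_of_le_right ?_
    rw [abs_mul, abs_of_pos (Real.exp_pos _)]
    exact mul_le_mul_of_nonneg_left
      ((abs_add_le _ _).trans (add_le_add_left (hb z hz) _)) (Real.exp_pos _).le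
  · refine le_max_of_le_left ?_
    rw [abs_of_pos (Real.exp_pos _)]; exact hE z hz
  · have h1 := Real.add_one_le_exp (a * f z - c)
    have h2 : Real.exp (a * f z) = Real.exp c * Real.exp (a * f z - c) := by
      rw [← Real.exp_add]; congr 1; ring
    rw [h2]
    exact mul_le_mul_of_nonneg_left (by linarith) (Real.exp_pos _).le

end Expectation

/-! ### Uniform deviation by symmetrization. -/

section Deviation

variable {Z : Type u} {ι : Type v}

theorem ex_iidList_succ (P : PMF Z) (m : ℕ) (F : List Z → ℝ≥0∞) :
    ex (iidList P (m + 1)) F = ex P fun z => ex (iidList P m) fun l => F (z :: l) := by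
  rw [iidList, ex_bind]
  simp only [ex_map]

theorem mem_support_iidList {P : PMF Z} {m : ℕ} {l : List Z} (h : l ∈ (iidList P m).support) :
    l.length = m ∧ ∀ z ∈ l, z ∈ P.support := by
  induction m generalizing l with
  | zero =>
    rw [iidList, PMF.mem_support_pure_iff] at h
    simp [h]
  | succ m ih =>
    rw [iidList, PMF.mem_support_bind_iff] at h
    obtain ⟨z, hz, h⟩ := h
    obtain ⟨l', hl', rfl⟩ := (PMF.mem_support_map_iff _ _ _).1 h
    obtain ⟨h1, h2⟩ := ih hl'
    refine ⟨by simp [h1], fun y hy => ?_⟩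
    rcases List.mem_cons.1 hy with rfl | hy
    · exact hz
    · exact h2 y hy

/-- The average of `Ψ` over all ways of exchanging entries of two lists at the same place. -/
noncomputable def swapAvg : List Z → List Z → (List Z → List Z → ℝ≥0∞) → ℝ≥0∞
  | a :: l, b :: l', Ψ =>
      (swapAvg l l' (fun x y => Ψ (a :: x) (b :: y)) +
        swapAvg l l' (fun x y => Ψ (b :: x) (a :: y))) / 2
  | _, _, Ψ => Ψ [] []

/-- Two independent samples are exchangeable place by place: swapping the two heads preserves the
joint law, so both halves of the average have the same expectation. -/
theorem ex_swapAvg (P : PMF Z) (m : ℕ) (Ψ : List Z → List Z → ℝ≥0∞) :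
    (ex (iidList P m) fun l => ex (iidList P m) fun l' => swapAvg l l' Ψ) =
      ex (iidList P m) fun l => ex (iidList P m) fun l' => Ψ l l' := by
  induction m generalizing Ψ with
  | zero => simp [iidList, ex_pure, swapAvg]
  | succ m ih =>
    simp only [ex_iidList_succ, swapAvg, div_eq_mul_inv, ex_mul_right, ex_add]
    simp only [ex_comm (iidList P m) P, ih]
    rw [ex_comm P P fun a b => ex (iidList P m) fun l => ex (iidList P m) fun l' =>
      Ψ (b :: l) (a :: l'), ← two_mul, mul_comm, ← mul_assoc,
      ENNReal.inv_mul_cancel two_ne_zero ENNReal.ofNat_ne_top, one_mul]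

theorem swapAvg_mono {l l' : List Z} {Ψ Φ : List Z → List Z → ℝ≥0∞}
    (h : ∀ x y, (∀ z ∈ x, z ∈ l ++ l') → (∀ z ∈ y, z ∈ l ++ l') → Ψ x y ≤ Φ x y) :
    swapAvg l l' Ψ ≤ swapAvg l l' Φ := by
  induction l generalizing l' Ψ Φ with
  | nil => simpa [swapAvg] using h [] [] (by simp) (by simp)
  | cons a l ih =>
    cases l' with
    | nil => simpa [swapAvg] using h [] [] (by simp) (by simp)
    | cons b l' =>
      have aux : ∀ {c : Z} {x : List Z}, c ∈ [a, b] → (∀ z ∈ x, z ∈ l ++ l') →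
          ∀ z ∈ c :: x, z ∈ a :: l ++ b :: l' := by
        intro c x hc hx z hz
        rcases List.mem_cons.1 hz with rfl | hz
        · simp at hc ⊢; tauto
        · have := hx z hz; simp at this ⊢; tauto
      refine ENNReal.div_le_div_right (add_le_add ?_ ?_) 2
      · exact ih fun x y hx hy => h _ _ (aux (by simp) hx) (aux (by simp) hy)
      · exact ih fun x y hx hy => h _ _ (aux (by simp) hx) (aux (by simp) hy)

theorem swapAvg_finset_sum (s : Finset ι) (l l' : List Z) (Ψ : ι → List Z → List Z → ℝ≥0∞) :
    swapAvg l l' (fun x y => ∑ i ∈ s, Ψ i x y) = ∑ i ∈ s, swapAvg l l' (Ψ i) := by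
  induction l generalizing l' Ψ with
  | nil => simp [swapAvg]
  | cons a l ih =>
    cases l' with
    | nil => simp [swapAvg]
    | cons b l' =>
      simp only [swapAvg, div_eq_mul_inv, ih, ← Finset.sum_add_distrib, Finset.sum_mul]

/-- The moment generating function of a difference of sums with random signs. -/
theorem swapAvg_exp_le {f : Z → ℝ} (a : ℝ) {m : ℕ} {l l' : List Z} (hl : l.length = m)
    (hl' : l'.length = m) (hf : ∀ z ∈ l ++ l', |f z| ≤ 1) (c : ℝ≥0∞) :
    swapAvg l l' (fun x y => c * ENNReal.ofReal (Real.exp (a * ((y.map f).sum - (x.map f).sum)))) ≤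
      c * ENNReal.ofReal (Real.exp (m * (2 * a ^ 2))) := by
  induction m generalizing l l' c with
  | zero =>
    rw [List.length_eq_zero_iff] at hl hl'
    simp [hl, hl', swapAvg]
  | succ m ih =>
    obtain ⟨z, l, rfl⟩ := List.exists_cons_of_length_eq_add_one hl
    obtain ⟨w, l', rfl⟩ := List.exists_cons_of_length_eq_add_one hl'
    simp only [List.length_cons, add_left_inj] at hl hl'
    have hf' : ∀ y ∈ l ++ l', |f y| ≤ 1 := fun y hy => hf y (by simp at hy ⊢; tauto)
    have hz := abs_le.1 (hf z (by simp))
    have hw := abs_le.1 (hf w (by simp))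
    have split : ∀ (p q : Z) (x y : List Z),
        c * ENNReal.ofReal (Real.exp (a * (((q :: y).map f).sum - ((p :: x).map f).sum))) =
          c * ENNReal.ofReal (Real.exp (a * (f q - f p))) *
            ENNReal.ofReal (Real.exp (a * ((y.map f).sum - (x.map f).sum))) := by
      intro p q x y
      rw [mul_assoc, ← ENNReal.ofReal_mul (Real.exp_pos _).le, ← Real.exp_add]
      simp only [List.map_cons, List.sum_cons]
      congr 3; ring
    simp only [swapAvg, split]
    refine (ENNReal.div_le_div_right (add_le_add (ih hl hl' hf' _) (ih hl hl' hf' _)) 2).trans ?_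
    set u := a * (f w - f z) with hu
    have hu' : a * (f z - f w) = -u := by rw [hu]; ring
    have hcosh : (Real.exp u + Real.exp (-u)) / 2 ≤ Real.exp (2 * a ^ 2) := by
      rw [← Real.cosh_eq]
      refine (Real.cosh_le_exp_half_sq u).trans (Real.exp_le_exp.2 ?_)
      have : (f w - f z) ^ 2 ≤ 4 := by nlinarith
      rw [hu, mul_pow]
      nlinarith [sq_nonneg a]
    have e : ENNReal.ofReal (Real.exp ((m + 1 : ℕ) * (2 * a ^ 2))) =
        ENNReal.ofReal (Real.exp (2 * a ^ 2)) * ENNReal.ofReal (Real.exp (m * (2 * a ^ 2))) := by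
      rw [← ENNReal.ofReal_mul (Real.exp_pos _).le, ← Real.exp_add]
      congr 2; push_cast; ring
    rw [hu', e, ← add_mul, ← mul_add, ← ENNReal.ofReal_add (Real.exp_pos _).le (Real.exp_pos _).le,
      mul_assoc, mul_div_assoc]
    refine mul_le_mul_right ?_ c
    rw [mul_comm, mul_div_assoc, mul_comm]
    refine mul_le_mul_left ?_ _
    rw [show (2 : ℝ≥0∞) = ENNReal.ofReal 2 by simp, ← ENNReal.ofReal_div_of_pos two_pos]
    exact ENNReal.ofReal_le_ofReal hcosh

/-- Jensen's inequality, tensorized. It replaces the true mean by the sum over an independent ghost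
sample. -/
theorem ofReal_exp_mean_sum_le {P : PMF Z} {f : Z → ℝ} (hf : ∀ z ∈ P.support, |f z| ≤ 1) (a : ℝ)
    (m : ℕ) : ENNReal.ofReal (Real.exp (a * (m * mean P f))) ≤
      ex (iidList P m) fun l => ENNReal.ofReal (Real.exp (a * (l.map f).sum)) := by
  induction m with
  | zero => simp [iidList, ex_pure]
  | succ m ih =>
    have e : Real.exp (a * ((m + 1 : ℕ) * mean P f)) =
        Real.exp (a * mean P f) * Real.exp (a * (m * mean P f)) := by
      rw [← Real.exp_add]; congr 1; push_cast; ring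
    rw [e, ex_iidList_succ, ENNReal.ofReal_mul (Real.exp_pos _).le]
    simp only [List.map_cons, List.sum_cons, mul_add, Real.exp_add,
      ENNReal.ofReal_mul (Real.exp_pos _).le, ex_mul_left, ex_mul_right]
    exact mul_le_mul' (ofReal_exp_mean_le hf a) ih

theorem sum_map_neg (f : Z → ℝ) (l : List Z) : (l.map fun z => -f z).sum = -(l.map f).sum := by
  induction l with
  | nil => simp
  | cons a l ih => simp only [List.map_cons, List.sum_cons, ih, neg_add]

/-- One-sided uniform deviation of empirical sums, for a family of functions that has at most
`Γ` different restrictions to any `2 * m` points. -/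
theorem one_sided_deviation {P : PMF Z} {s : Finset ι} {f : ι → Z → ℝ}
    (hf : ∀ i ∈ s, ∀ z ∈ P.support, |f i z| ≤ 1) {m : ℕ} {Γ : ℝ}
    (hΓ : ∀ l : List Z, l.length = 2 * m → ∃ R ⊆ s, (R.card : ℝ) ≤ Γ ∧
      ∀ i ∈ s, ∃ r ∈ R, ∀ z ∈ l, f i z = f r z) {t : ℝ} (ht : 0 ≤ t) :
    (iidList P m).toOuterMeasure {l | ∃ i ∈ s, m * t ≤ m * mean P (f i) - (l.map (f i)).sum} ≤
      ENNReal.ofReal (Γ * Real.exp (-(m * t ^ 2 / 8))) := by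
  -- This value minimizes the final exponent `2 * m * a ^ 2 - a * m * t`, with minimum `-(m * t ^ 2
  -- / 8)`.
  set a := t / 4 with ha
  have ha0 : 0 ≤ a := by positivity
  set Ψ : ι → List Z → List Z → ℝ≥0∞ := fun i l l' =>
    ENNReal.ofReal (Real.exp (a * ((l'.map (f i)).sum - (l.map (f i)).sum))) with hΨ
  -- Markov's inequality for the exponential moment, with the mean replaced by a ghost sample `l'`.
  have step1 : (iidList P m).toOuterMeasure
      {l | ∃ i ∈ s, m * t ≤ m * mean P (f i) - (l.map (f i)).sum} ≤
      ENNReal.ofReal (Real.exp (-(a * (m * t)))) *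
        ex (iidList P m) fun l => ex (iidList P m) fun l' => s.sup fun i => Ψ i l l' := by
    rw [toOuterMeasure_eq_ex, ← ex_mul_left]
    refine ex_mono fun l => Set.indicator_apply_le' (fun hl => ?_) (fun _ => zero_le)
    obtain ⟨i, hi, h⟩ := hl
    have h1 : (1 : ℝ≥0∞) ≤ ENNReal.ofReal (Real.exp (-(a * (m * t)))) *
        (ENNReal.ofReal (Real.exp (-(a * (l.map (f i)).sum))) *
          ENNReal.ofReal (Real.exp (a * (m * mean P (f i))))) := by
      rw [← ENNReal.ofReal_mul (Real.exp_pos _).le, ← ENNReal.ofReal_mul (Real.exp_pos _).le,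
        ← Real.exp_add, ← Real.exp_add, ← ENNReal.ofReal_one]
      refine ENNReal.ofReal_le_ofReal (Real.one_le_exp ?_)
      nlinarith [mul_le_mul_of_nonneg_left h ha0]
    refine h1.trans (mul_le_mul_right ?_ _)
    refine (mul_le_mul_right (ofReal_exp_mean_sum_le (hf i hi) a m) _).trans ?_
    rw [← ex_mul_left]
    refine ex_mono fun l' => ?_
    refine le_trans (le_of_eq ?_) (Finset.le_sup (f := fun i => Ψ i l l') hi)
    rw [hΨ]
    simp only
    rw [← ENNReal.ofReal_mul (Real.exp_pos _).le, ← Real.exp_add]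
    congr 2; ring
  have step2 : (ex (iidList P m) fun l => ex (iidList P m) fun l' => s.sup fun i => Ψ i l l') ≤
      ENNReal.ofReal (Γ * Real.exp (m * (2 * a ^ 2))) := by
    rw [← ex_swapAvg, ← ex_const (iidList P m) (ENNReal.ofReal (Γ * Real.exp (m * (2 * a ^ 2))))]
    refine ex_mono_of_support fun l hl => ?_
    rw [← ex_const (iidList P m) (ENNReal.ofReal (Γ * Real.exp (m * (2 * a ^ 2))))]
    refine ex_mono_of_support fun l' hl' => ?_
    obtain ⟨hl1, hl2⟩ := mem_support_iidList hl
    obtain ⟨hl'1, hl'2⟩ := mem_support_iidList hl'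
    -- Exchanging entries creates no new points, so one set of representatives on `l ++ l'` serves
    -- all exchanges, and the supremum is at most a sum of at most `Γ` terms.
    obtain ⟨R, hRs, hR, hrep⟩ := hΓ (l ++ l') (by simp [hl1, hl'1, two_mul])
    calc swapAvg l l' (fun x y => s.sup fun i => Ψ i x y)
        ≤ swapAvg l l' (fun x y => ∑ r ∈ R, Ψ r x y) := by
          refine swapAvg_mono fun x y hx hy => Finset.sup_le fun i hi => ?_
          obtain ⟨r, hr, hir⟩ := hrep i hi
          refine le_trans (le_of_eq ?_)
            (Finset.single_le_sum (f := fun r => Ψ r x y) (fun _ _ => zero_le) hr)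
          rw [hΨ]
          simp only
          rw [List.map_congr_left fun z hz => hir z (hx z hz),
            List.map_congr_left fun z hz => hir z (hy z hz)]
      _ = ∑ r ∈ R, swapAvg l l' (Ψ r) := swapAvg_finset_sum R l l' Ψ
      _ ≤ ∑ r ∈ R, ENNReal.ofReal (Real.exp (m * (2 * a ^ 2))) := by
          refine Finset.sum_le_sum fun r hr => ?_
          have := swapAvg_exp_le a hl1 hl'1 (f := f r) (fun z hz => by
            rcases List.mem_append.1 hz with h | h
            · exact hf r (hRs hr) z (hl2 z h)
            · exact hf r (hRs hr) z (hl'2 z h)) 1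
          simpa [hΨ] using this
      _ ≤ ENNReal.ofReal (Γ * Real.exp (m * (2 * a ^ 2))) := by
          rw [Finset.sum_const, nsmul_eq_mul, ← ENNReal.ofReal_natCast,
            ← ENNReal.ofReal_mul (Nat.cast_nonneg _)]
          exact ENNReal.ofReal_le_ofReal (mul_le_mul_of_nonneg_right hR (Real.exp_pos _).le)
  refine (step1.trans (mul_le_mul_right step2 _)).trans (le_of_eq ?_)
  rw [← ENNReal.ofReal_mul (Real.exp_pos _).le, mul_left_comm, ← Real.exp_add]
  congr 3; rw [ha]; ring

/-- Two-sided uniform deviation of empirical sums. -/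
theorem uniform_deviation {P : PMF Z} {s : Finset ι} {f : ι → Z → ℝ}
    (hf : ∀ i ∈ s, ∀ z ∈ P.support, |f i z| ≤ 1) {m : ℕ} {Γ : ℝ}
    (hΓ : ∀ l : List Z, l.length = 2 * m → ∃ R ⊆ s, (R.card : ℝ) ≤ Γ ∧
      ∀ i ∈ s, ∃ r ∈ R, ∀ z ∈ l, f i z = f r z) {t : ℝ} (ht : 0 ≤ t) :
    (iidList P m).toOuterMeasure {l | ∃ i ∈ s, m * t ≤ |m * mean P (f i) - (l.map (f i)).sum|} ≤
      ENNReal.ofReal (2 * Γ * Real.exp (-(m * t ^ 2 / 8))) := by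
  have h1 := one_sided_deviation hf hΓ ht
  have h2 := one_sided_deviation (P := P) (s := s) (f := fun i z => -f i z) (m := m) (Γ := Γ)
    (fun i hi z hz => by rw [abs_neg]; exact hf i hi z hz) (fun l hl => by
      obtain ⟨R, hR, hc, h⟩ := hΓ l hl
      refine ⟨R, hR, hc, fun i hi => ?_⟩
      obtain ⟨r, hr, h⟩ := h i hi
      exact ⟨r, hr, fun z hz => by rw [h z hz]⟩) ht
  have hΓ0 : 0 ≤ Γ := by
    obtain ⟨z, -⟩ := P.support_nonempty
    obtain ⟨R, -, hR, -⟩ := hΓ (List.replicate (2 * m) z) (by simp)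
    exact (Nat.cast_nonneg _).trans hR
  have hpos : 0 ≤ Γ * Real.exp (-(m * t ^ 2 / 8)) := mul_nonneg hΓ0 (Real.exp_pos _).le
  rw [mul_assoc, two_mul, ENNReal.ofReal_add hpos hpos]
  refine (((iidList P m).toOuterMeasure.mono ?_).trans
    (MeasureTheory.measure_union_le _ _)).trans (add_le_add h1 h2)
  rintro l ⟨i, hi, h⟩
  rcases le_abs.1 h with h | h
  · exact Or.inl ⟨i, hi, h⟩
  · refine Or.inr ⟨i, hi, h.trans (le_of_eq ?_)⟩
    rw [mean_neg, sum_map_neg]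
    ring

/-- Deviation of the empirical sum of a single function. -/
theorem single_deviation {P : PMF Z} {f : Z → ℝ} (hf : ∀ z ∈ P.support, |f z| ≤ 1) (m : ℕ) {t : ℝ}
    (ht : 0 ≤ t) :
    (iidList P m).toOuterMeasure {l | m * t ≤ |m * mean P f - (l.map f).sum|} ≤
      ENNReal.ofReal (2 * Real.exp (-(m * t ^ 2 / 8))) := by
  have := uniform_deviation (P := P) (s := {()}) (f := fun _ => f) (m := m) (Γ := 1)
    (fun _ _ => hf) (fun l _ => ⟨{()}, subset_rfl, by simp, fun i hi => ⟨i, hi, fun _ _ => rfl⟩⟩) ht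
  simpa using this

end Deviation

/-! ### The empirical weak agnostic learner. -/

section Learner

open Classical in
/-- A form of the Sauer-Shelah lemma: the number of traces on `A` of a family of sets. -/
theorem card_traces_le {α : Type u} (𝒜 : Finset (Finset α)) (A : Finset α) {x : ℝ} (hx : 0 < x)
    (hx1 : x ≤ 1) :
    ((𝒜.image fun t => A ∩ t).card : ℝ) ≤ (x ^ 𝒜.vcDim)⁻¹ * Real.exp (A.card * x) := by
  set d := 𝒜.vcDim
  have h1 : (𝒜.image fun t => A ∩ t).card ≤ (A.powerset.filter fun s => s.card ≤ d).card := by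
    refine (Finset.card_le_card_shatterer _).trans (Finset.card_le_card fun s hs => ?_)
    rw [Finset.mem_shatterer] at hs
    have hsA : s ⊆ A := by
      obtain ⟨t, ht, hst⟩ := hs.exists_superset
      obtain ⟨t', -, rfl⟩ := Finset.mem_image.1 ht
      exact hst.trans Finset.inter_subset_left
    refine Finset.mem_filter.2 ⟨Finset.mem_powerset.2 hsA, Finset.Shatters.card_le_vcDim ?_⟩
    intro t ht
    obtain ⟨u, hu, hut⟩ := hs ht
    obtain ⟨u', hu', rfl⟩ := Finset.mem_image.1 hu
    refine ⟨u', hu', ?_⟩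
    rw [← hut, ← Finset.inter_assoc, Finset.inter_eq_left.2 hsA]
  -- Each set of size at most `d` has weight `x ^ s.card / x ^ d ≥ 1`; summing the weights over all
  -- subsets of `A` gives `(1 + x) ^ A.card / x ^ d`.
  have h2 : ((A.powerset.filter fun s => s.card ≤ d).card : ℝ) ≤
      (x ^ d)⁻¹ * ∑ s ∈ A.powerset, x ^ s.card * 1 ^ (A.card - s.card) := by
    rw [Finset.card_eq_sum_ones, Nat.cast_sum, Finset.mul_sum]
    refine (Finset.sum_le_sum fun s hs => ?_).trans
      (Finset.sum_le_sum_of_subset_of_nonneg (Finset.filter_subset _ _) fun s _ _ => by positivity)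
    have hd := (Finset.mem_filter.1 hs).2
    rw [one_pow, mul_one, Nat.cast_one, inv_mul_eq_div, one_le_div (by positivity)]
    exact pow_le_pow_of_le_one hx.le hx1 hd
  rw [Finset.sum_pow_mul_eq_add_pow] at h2
  refine ((Nat.cast_le.2 h1).trans h2).trans (mul_le_mul_of_nonneg_left ?_ (by positivity))
  rw [Real.exp_nat_mul]
  exact pow_le_pow_left₀ (by positivity) (Real.add_one_le_exp x) _

/-- One function is chosen for each trace on `A`, and traces are counted by `card_traces_le`. The
free parameter `x` is later traded against the exponent of the deviation bound. -/
theorem exists_representatives {X : Type u} [Fintype X] (C : Finset (X → Bool)) (A : Finset X)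
    {x : ℝ} (hx : 0 < x) (hx1 : x ≤ 1) :
    ∃ R ⊆ C, (R.card : ℝ) ≤ (x ^ vc C)⁻¹ * Real.exp (A.card * x) ∧
      ∀ c ∈ C, ∃ r ∈ R, ∀ z ∈ A, c z = r z := by
  classical
  set supp : (X → Bool) → Finset X := fun c => Finset.univ.filter fun x => c x = true with hsupp
  set g : (X → Bool) → Finset X := fun c => A ∩ supp c with hg
  refine ⟨(C.image g).image (Function.invFunOn g C), ?_, ?_, ?_⟩
  · intro r hr
    obtain ⟨T, hT, rfl⟩ := Finset.mem_image.1 hr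
    obtain ⟨c, hc, rfl⟩ := Finset.mem_image.1 hT
    exact Function.invFunOn_mem ⟨c, hc, rfl⟩
  · refine (Nat.cast_le.2 Finset.card_image_le).trans ?_
    have := card_traces_le (C.image supp) A hx hx1
    rw [Finset.image_image] at this
    have hvc : vc C = (C.image supp).vcDim := by unfold vc; congr!
    have hcard : (C.image g).card = (C.image ((fun t => A ∩ t) ∘ supp)).card := by
      congr 1
    rw [hvc, hcard]
    convert this using 2
  · intro c hc
    refine ⟨_, Finset.mem_image_of_mem _ (Finset.mem_image_of_mem _ hc), fun z hz => ?_⟩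
    have h : g (Function.invFunOn g C (g c)) = g c := Function.invFunOn_eq ⟨c, hc, rfl⟩
    have h' := Finset.ext_iff.1 h z
    simp only [hg, hsupp, Finset.mem_inter, hz, true_and, Finset.mem_filter, Finset.mem_univ] at h'
    exact (Bool.eq_iff_iff.2 h').symm

/-- The contribution of a labeled datum to the correlation with `c`. -/
noncomputable def score {X : Type u} (c : X → Bool) (z : X × ℝ) : ℝ :=
  if c z.1 = true then z.2 else 0

theorem corr_eq_mean {X : Type u} (P : PMF (X × ℝ)) (c : X → Bool) :
    corr P c = mean P (score c) := rfl

theorem abs_score_le {X : Type u} (c : X → Bool) {z : X × ℝ} (hz : z.2 ∈ Set.Icc (-1 : ℝ) 1) :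
    |score c z| ≤ 1 := by
  unfold score
  split_ifs
  · exact abs_le.2 hz
  · simp

open Classical in
/-- The learner that returns a function of `C` with empirical correlation above `3 / 4 * ε`. -/
noncomputable def empiricalLearner {X : Type u} (C : Finset (X → Bool)) : Learner X :=
  fun ε data =>
    if h : ∃ c ∈ C, 3 / 4 * ε * data.length < (data.map (score c)).sum
    then PMF.pure (some h.choose) else PMF.pure none

theorem correlation_deviation {X : Type u} [Fintype X] {C : Finset (X → Bool)} (hC : 1 ≤ vc C)
    {P : PMF (X × ℝ)} (hP : ∀ z ∈ P.support, z.2 ∈ Set.Icc (-1 : ℝ) 1) {ε β : ℝ} {m : ℕ}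
    (hε : 0 < ε) (hε1 : ε < 1) (hβ : 0 < β) (hβ1 : β < 1)
    (hm : 2048 * (vc C * Real.log (2 / ε) + Real.log (1 / β)) / ε ^ 2 ≤ m) :
    (iidList P m).toOuterMeasure
      {l | ∃ c ∈ C, m * (ε / 4) ≤ |m * mean P (score c) - (l.map (score c)).sum|} ≤
      ENNReal.ofReal β := by
  classical
  -- With this choice the growth term `2 * m * x` is a quarter of the deviation exponent `m * (ε /
  -- 4) ^ 2 / 8`, while `-log x` is still at most `10 * log (2 / ε)`.
  set x := ε ^ 2 / 1024 with hx
  have hx0 : 0 < x := by positivity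
  have hx1 : x ≤ 1 := by rw [hx]; nlinarith
  set d := vc C
  have hdev := uniform_deviation (P := P) (s := C) (f := score) (m := m)
    (Γ := (x ^ d)⁻¹ * Real.exp (2 * m * x)) (fun c _ z hz => abs_score_le c (hP z hz))
    (fun l hl => by
      obtain ⟨R, hR, hc, h⟩ := exists_representatives C (l.map Prod.fst).toFinset hx0 hx1
      refine ⟨R, hR, hc.trans ?_, fun c hc' => ?_⟩
      · refine mul_le_mul_of_nonneg_left (Real.exp_le_exp.2 ?_) (by positivity)
        refine mul_le_mul_of_nonneg_right ?_ hx0.le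
        have : (l.map Prod.fst).toFinset.card ≤ 2 * m :=
          (List.toFinset_card_le _).trans (by simp [hl])
        exact_mod_cast this
      · obtain ⟨r, hr, h⟩ := h c hc'
        refine ⟨r, hr, fun z hz => ?_⟩
        unfold score
        rw [h z.1 (by simpa using ⟨z.2, hz⟩)]) (t := ε / 4) (by positivity)
  refine hdev.trans (ENNReal.ofReal_le_ofReal ?_)
  set L := Real.log (2 / ε) with hL
  have hlog2 : Real.log 2 ≤ L := Real.log_le_log two_pos (by rw [le_div_iff₀ hε]; linarith)
  have hlog20 : 0 < Real.log 2 := Real.log_pos one_lt_two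
  have hL0 : 0 < L := hlog20.trans_le hlog2
  have hd : (1 : ℝ) ≤ d := by exact_mod_cast hC
  have hdL : Real.log 2 ≤ d * L := by nlinarith
  have hB0 : 0 < Real.log (1 / β) := Real.log_pos (by rw [lt_div_iff₀ hβ]; linarith)
  have hlogx : -Real.log x ≤ 10 * L := by
    rw [hx, Real.log_div (by positivity) (by norm_num), hL, Real.log_div (by norm_num) hε.ne',
      Real.log_pow, show (1024 : ℝ) = 2 ^ 10 by norm_num, Real.log_pow]
    have := Real.log_nonpos hε.le hε1.le
    push_cast
    linarith
  rw [div_le_iff₀ (by positivity)] at hm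
  have e1 : 2 * ((x ^ d)⁻¹ * Real.exp (2 * m * x)) * Real.exp (-(m * (ε / 4) ^ 2 / 8)) =
      Real.exp (Real.log 2 + d * (-Real.log x) + 2 * m * x - m * (ε / 4) ^ 2 / 8) := by
    have e0 : Real.exp (d * (-Real.log x)) = (x ^ d)⁻¹ := by
      rw [Real.exp_nat_mul, Real.exp_neg, Real.exp_log hx0, inv_pow]
    rw [sub_eq_add_neg, Real.exp_add, Real.exp_add, Real.exp_add, Real.exp_log two_pos, e0]
    ring
  rw [e1, ← Real.le_log_iff_exp_le hβ]
  have e2 : Real.log (1 / β) = -Real.log β := by rw [one_div, Real.log_inv]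
  have h3 : (d : ℝ) * (-Real.log x) ≤ d * (10 * L) :=
    mul_le_mul_of_nonneg_left hlogx (by linarith)
  have e4 : 2 * m * x - m * (ε / 4) ^ 2 / 8 = -(12 / 2048 * (m * ε ^ 2)) := by rw [hx]; ring
  linarith

theorem standardLearner_empiricalLearner {X : Type u} [Fintype X] {C : Finset (X → Bool)}
    (hC : 1 ≤ vc C) : StandardLearner 2048 C (empiricalLearner C) := by
  classical
  constructor
  · intro ε data c hc
    unfold empiricalLearner at hc
    split_ifs at hc with h
    · rw [PMF.mem_support_pure_iff, Option.some_inj] at hc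
      exact hc ▸ h.choose_spec.1
    · simp at hc
  · intro P hP ε β m hε hε1 hβ hβ1 hm
    have hdev := correlation_deviation hC hP hε hε1 hβ hβ1 hm
    -- Both guarantees reduce to a deterministic claim about samples on which all empirical
    -- correlations are accurate to within `ε / 4`.
    have hsucc : ∀ A : Set (Option (X → Bool)),
        (∀ l : List (X × ℝ), l.length = m →
          (∀ c ∈ C, |m * mean P (score c) - (l.map (score c)).sum| < m * (ε / 4)) →
          ∀ r ∈ (empiricalLearner C ε l).support, r ∈ A) →
        1 - β ≤ pr (learn (empiricalLearner C) ε P m) A := by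
      intro A hA
      rw [one_sub_le_pr_iff hβ.le]
      refine le_trans ?_ hdev
      rw [learn, toOuterMeasure_bind, toOuterMeasure_eq_ex]
      refine ex_mono_of_support fun l hl => ?_
      by_cases hbad : ∃ c ∈ C, m * (ε / 4) ≤ |m * mean P (score c) - (l.map (score c)).sum|
      · rw [Set.indicator_of_mem (by exact hbad)]
        exact toOuterMeasure_le_one _ _
      · push Not at hbad
        refine le_of_eq_of_le ?_ zero_le
        rw [PMF.toOuterMeasure_apply_eq_zero_iff, Set.disjoint_compl_right_iff_subset]
        exact hA l (mem_support_iidList hl).1 hbad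
    have hm0 : (0 : ℝ) < m := by
      refine lt_of_lt_of_le ?_ hm
      have h1 : 0 < Real.log (2 / ε) := Real.log_pos (by rw [lt_div_iff₀ hε]; linarith)
      have h2 : 0 < Real.log (1 / β) := Real.log_pos (by rw [lt_div_iff₀ hβ]; linarith)
      positivity
    have hfound : ∀ l : List (X × ℝ), l.length = m →
        (∀ c ∈ C, |m * mean P (score c) - (l.map (score c)).sum| < m * (ε / 4)) →
        ∀ c ∈ C, 3 / 4 * ε * l.length < (l.map (score c)).sum → ε / 2 < corr P c := by
      intro l hl hgood c hc h2
      have h3 := (abs_lt.1 (hgood c hc)).1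
      rw [hl] at h2
      rw [corr_eq_mean]
      refine lt_of_mul_lt_mul_left ?_ hm0.le
      linarith
    constructor
    · rintro ⟨c, hc, hcorr⟩
      refine hsucc _ fun l hl hgood r hr => ?_
      unfold empiricalLearner at hr
      split_ifs at hr with h
      · rw [PMF.mem_support_pure_iff] at hr
        exact ⟨_, h.choose_spec.1, hr, hfound l hl hgood _ h.choose_spec.1 h.choose_spec.2⟩
      · exfalso
        refine h ⟨c, hc, ?_⟩
        have h3 := (abs_lt.1 (hgood _ hc)).2
        have h4 := mul_lt_mul_of_pos_left hcorr hm0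
        rw [corr_eq_mean] at h4
        rw [hl]
        linarith
    · intro _
      refine hsucc _ fun l hl hgood r hr => ?_
      unfold empiricalLearner at hr
      split_ifs at hr with h
      · rw [PMF.mem_support_pure_iff] at hr
        exact Or.inl ⟨_, h.choose_spec.1, hr, hfound l hl hgood _ h.choose_spec.1 h.choose_spec.2⟩
      · rw [PMF.mem_support_pure_iff] at hr
        exact Or.inr hr

end Learner

/-! ### Anticoncentration of random subset sums. -/

section Anticoncentration

variable {κ : Type u}

-- Second moment of a sum with random signs, `E` being the set of plus signs. Adding a coordinate
-- pairs the two signs of `v a`, and the cross terms cancel.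
open Classical in
theorem sum_sq_signed (v : κ → ℝ) (s : Finset κ) :
    ∑ E ∈ s.powerset, (∑ k ∈ E, v k - ∑ k ∈ s \ E, v k) ^ 2 = 2 ^ s.card * ∑ k ∈ s, v k ^ 2 := by
  induction s using Finset.induction_on with
  | empty => simp
  | insert a s ha ih =>
    rw [Finset.sum_powerset_insert ha, Finset.card_insert_of_notMem ha, Finset.sum_insert ha,
      ← Finset.sum_add_distrib]
    have : ∀ E ∈ s.powerset, (∑ k ∈ E, v k - ∑ k ∈ insert a s \ E, v k) ^ 2 +
        (∑ k ∈ insert a E, v k - ∑ k ∈ insert a s \ insert a E, v k) ^ 2 =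
        2 * (∑ k ∈ E, v k - ∑ k ∈ s \ E, v k) ^ 2 + 2 * v a ^ 2 := by
      intro E hE
      have haE : a ∉ E := fun h => ha (Finset.mem_powerset.1 hE h)
      rw [Finset.insert_sdiff_of_notMem _ haE, Finset.sum_insert (by simp [ha]),
        Finset.sum_insert haE, Finset.insert_sdiff_insert, Finset.sdiff_insert_of_notMem ha]
      ring
    rw [Finset.sum_congr rfl this, Finset.sum_add_distrib, ← Finset.mul_sum, ih]
    simp only [Finset.sum_const, Finset.card_powerset, nsmul_eq_mul]
    push_cast
    ring

-- Same pairing as for the second moment; the surviving middle term `12 * v a ^ 2 * (…) ^ 2` is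
-- evaluated by `sum_sq_signed`.
open Classical in
theorem sum_fourth_signed_le (v : κ → ℝ) (s : Finset κ) :
    ∑ E ∈ s.powerset, (∑ k ∈ E, v k - ∑ k ∈ s \ E, v k) ^ 4 ≤
      3 * 2 ^ s.card * (∑ k ∈ s, v k ^ 2) ^ 2 := by
  induction s using Finset.induction_on with
  | empty => simp
  | insert a s ha ih =>
    rw [Finset.sum_powerset_insert ha, Finset.card_insert_of_notMem ha, Finset.sum_insert ha,
      ← Finset.sum_add_distrib]
    have : ∀ E ∈ s.powerset, (∑ k ∈ E, v k - ∑ k ∈ insert a s \ E, v k) ^ 4 +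
        (∑ k ∈ insert a E, v k - ∑ k ∈ insert a s \ insert a E, v k) ^ 4 =
        2 * (∑ k ∈ E, v k - ∑ k ∈ s \ E, v k) ^ 4 +
          12 * v a ^ 2 * (∑ k ∈ E, v k - ∑ k ∈ s \ E, v k) ^ 2 + 2 * v a ^ 4 := by
      intro E hE
      have haE : a ∉ E := fun h => ha (Finset.mem_powerset.1 hE h)
      rw [Finset.insert_sdiff_of_notMem _ haE, Finset.sum_insert (by simp [ha]),
        Finset.sum_insert haE, Finset.insert_sdiff_insert, Finset.sdiff_insert_of_notMem ha]
      ring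
    rw [Finset.sum_congr rfl this, Finset.sum_add_distrib, Finset.sum_add_distrib,
      ← Finset.mul_sum, ← Finset.mul_sum, sum_sq_signed]
    simp only [Finset.sum_const, Finset.card_powerset, nsmul_eq_mul]
    push_cast
    set Q := ∑ k ∈ s, v k ^ 2
    have hp : (0 : ℝ) < 2 ^ s.card := by positivity
    have : 0 ≤ (2 : ℝ) ^ s.card * v a ^ 4 := by positivity
    rw [pow_succ (2 : ℝ) s.card]
    nlinarith

open Classical in
/-- A random subset of the coordinates of a vector with sum zero has, with probability at least
`1 / 10`, a sum as large as the `ℓ¹` norm over four times the square root of the dimension. -/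
theorem two_pow_le_card_large_sum [Fintype κ] {v : κ → ℝ} (hv : ∑ k, v k = 0) {a : ℝ} (ha : 0 < a)
    (hva : a < ∑ k, |v k|) :
    (2 : ℝ) ^ Fintype.card κ ≤ 10 * ((Finset.univ : Finset (Finset κ)).filter fun E =>
      a / (4 * Real.sqrt (Fintype.card κ)) < ∑ k ∈ E, v k).card := by
  set N := Fintype.card κ
  set Q := ∑ k, v k ^ 2 with hQ
  set b := a / (4 * Real.sqrt N) with hb
  have hCS : (∑ k, |v k|) ^ 2 ≤ N * Q := by
    have := sq_sum_le_card_mul_sum_sq (s := (Finset.univ : Finset κ)) (f := fun k => |v k|)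
    simpa [sq_abs, hQ, N] using this
  have haQ : a ^ 2 < N * Q := lt_of_lt_of_le (pow_lt_pow_left₀ hva ha.le two_ne_zero) hCS
  have hQ0 : 0 ≤ Q := Finset.sum_nonneg fun k _ => sq_nonneg _
  have hNQ : 0 < N * Q := (by positivity : (0 : ℝ) ≤ a ^ 2).trans_lt haQ
  have hQpos : 0 < Q := by
    rcases hQ0.lt_or_eq with h | h
    · exact h
    · rw [← h, mul_zero] at hNQ; exact absurd hNQ (lt_irrefl _)
  have hNpos : (0 : ℝ) < N := pos_of_mul_pos_left hNQ hQ0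
  have hb0 : 0 < b := by positivity
  have hb2 : 16 * b ^ 2 < Q := by
    rw [hb, div_pow, mul_pow, Real.sq_sqrt hNpos.le]
    rw [show 16 * (a ^ 2 / (4 ^ 2 * (N : ℝ))) = a ^ 2 / N by ring, div_lt_iff₀ hNpos]
    linarith
  -- Since `v` sums to zero, a subset sum is half a signed sum, and passing to the complement
  -- changes its sign.
  have hD : ∀ E : Finset κ, ∑ k ∈ E, v k - ∑ k ∈ Finset.univ \ E, v k = 2 * ∑ k ∈ E, v k := by
    intro E
    have := Finset.sum_sdiff (f := v) (Finset.subset_univ E)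
    linarith
  have hM2 := sum_sq_signed v Finset.univ
  have hM4 := sum_fourth_signed_le v Finset.univ
  simp only [hD, Finset.powerset_univ, ← hQ, Finset.card_univ] at hM2 hM4
  change _ = 2 ^ N * Q at hM2
  change _ ≤ 3 * 2 ^ N * Q ^ 2 at hM4
  set U : Finset (Finset κ) := Finset.univ
  set L := U.filter fun E => b < ∑ k ∈ E, v k with hL
  set L' := U.filter fun E => ∑ k ∈ E, v k < -b with hL'
  have hLL' : L'.card = L.card := by
    refine Finset.card_bij' (fun E _ => Eᶜ) (fun E _ => Eᶜ) ?_ ?_ (by simp) (by simp)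
    all_goals
      intro E hE
      simp only [hL, hL', Finset.mem_filter] at hE ⊢
      have := Finset.sum_add_sum_compl E v
      refine ⟨Finset.mem_univ _, ?_⟩
      linarith [hE.2]
  -- A quadratic in the squared signed sum that is nonpositive when the subset sum is at most `b` in
  -- absolute value, and never exceeds `(27 / 8) ^ 2 * Q ^ 2 < 12 * Q ^ 2`. By the two moments its
  -- average is at least `5 / 2 * Q ^ 2`, so the two tails together have probability at least `5 /
  -- 24`, and each at least `1 / 10`.
  have hpoint : ∀ E ∈ U, ((2 * ∑ k ∈ E, v k) ^ 2 - Q / 4) * (7 * Q - (2 * ∑ k ∈ E, v k) ^ 2) ≤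
      12 * Q ^ 2 * ((if b < ∑ k ∈ E, v k then 1 else 0) + if ∑ k ∈ E, v k < -b then 1 else 0) := by
    intro E _
    set S := ∑ k ∈ E, v k
    by_cases h1 : b < S ∨ S < -b
    · have : (1 : ℝ) ≤ (if b < S then 1 else 0) + if S < -b then 1 else 0 := by
        rcases h1 with h | h
        · rw [if_pos h]; split_ifs <;> norm_num
        · rw [if_pos h]; split_ifs <;> norm_num
      have h2 := mul_le_mul_of_nonneg_left this (by positivity : 0 ≤ 12 * Q ^ 2)
      nlinarith [sq_nonneg ((2 * S) ^ 2 - 29 / 8 * Q), sq_nonneg Q]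
    · push Not at h1
      rw [if_neg (not_lt.2 h1.1), if_neg (not_lt.2 h1.2), add_zero, mul_zero]
      have h3 : S ^ 2 ≤ b ^ 2 := sq_le_sq' h1.2 h1.1
      refine mul_nonpos_of_nonpos_of_nonneg ?_ ?_ <;> nlinarith
  have hsum := Finset.sum_le_sum hpoint
  rw [← Finset.mul_sum, Finset.sum_add_distrib, Finset.sum_boole, Finset.sum_boole] at hsum
  change _ ≤ 12 * Q ^ 2 * ((L.card : ℝ) + L'.card) at hsum
  rw [hLL'] at hsum
  have hexp : ∑ E ∈ U, ((2 * ∑ k ∈ E, v k) ^ 2 - Q / 4) * (7 * Q - (2 * ∑ k ∈ E, v k) ^ 2) =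
      29 / 4 * Q * ∑ E ∈ U, (2 * ∑ k ∈ E, v k) ^ 2 - ∑ E ∈ U, (2 * ∑ k ∈ E, v k) ^ 4 -
        2 ^ N * (7 / 4 * Q ^ 2) := by
    have hU : (2 : ℝ) ^ N * (7 / 4 * Q ^ 2) = ∑ E ∈ U, 7 / 4 * Q ^ 2 := by
      simp [U, N, Fintype.card_finset]
    rw [hU, Finset.mul_sum U, ← Finset.sum_sub_distrib, ← Finset.sum_sub_distrib]
    refine Finset.sum_congr rfl fun E _ => ?_
    ring
  rw [hexp, hM2] at hsum
  have hQ2 : 0 < Q ^ 2 := by positivity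
  have : Q ^ 2 * 2 ^ N ≤ Q ^ 2 * (10 * L.card) := by
    have : (0 : ℝ) < 2 ^ N := by positivity
    nlinarith [mul_pos hQ2 this]
  exact le_of_mul_le_mul_left this hQ2

end Anticoncentration

/-! ### Logarithmic loss and multiplicative updates. -/

section Softmax

variable {X : Type u} {O : Type v} [Fintype O]

theorem sum_exp_pos [Nonempty O] (w : O → ℝ) : 0 < ∑ o, Real.exp (w o) :=
  Finset.sum_pos (fun o _ => Real.exp_pos (w o)) Finset.univ_nonempty

/-- The law on `O` with the given real probabilities. -/
noncomputable def ofReals (w : O → ℝ) (h0 : ∀ o, 0 ≤ w o) (h1 : ∑ o, w o = 1) : PMF O :=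
  PMF.ofFintype (fun o => ENNReal.ofReal (w o)) (by
    rw [← ENNReal.ofReal_sum_of_nonneg fun o _ => h0 o, h1, ENNReal.ofReal_one])

theorem ofReals_toReal (w : O → ℝ) (h0 : ∀ o, 0 ≤ w o) (h1 : ∑ o, w o = 1) (o : O) :
    (ofReals w h0 h1 o).toReal = w o := by
  rw [ofReals, PMF.ofFintype_apply, ENNReal.toReal_ofReal (h0 o)]

/-- The law with probabilities proportional to `exp (w o)`. -/
noncomputable def softmax [Nonempty O] (w : O → ℝ) : PMF O :=
  ofReals (fun o => Real.exp (w o) / ∑ o', Real.exp (w o'))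
    (fun o => div_nonneg (Real.exp_pos _).le (sum_exp_pos w).le)
    (by rw [← Finset.sum_div, div_self (sum_exp_pos w).ne'])

theorem softmax_toReal [Nonempty O] (w : O → ℝ) (o : O) :
    (softmax w o).toReal = Real.exp (w o) / ∑ o', Real.exp (w o') := ofReals_toReal _ _ _ o

/-- The expected logarithmic loss of the predictor `fun x => softmax (w x)`. -/
noncomputable def logLoss (D : PMF (X × O)) (w : X → O → ℝ) : ℝ :=
  mean D fun z => Real.log (∑ o, Real.exp (w z.1 o)) - w z.1 z.2

theorem logLoss_nonneg (D : PMF (X × O)) (w : X → O → ℝ) : 0 ≤ logLoss D w := by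
  refine tsum_nonneg fun z => mul_nonneg ENNReal.toReal_nonneg (sub_nonneg.2 ?_)
  rw [← Real.log_exp (w z.1 z.2)]
  refine Real.log_le_log (Real.exp_pos _) ?_
  exact Finset.single_le_sum (f := fun o => Real.exp (w z.1 o)) (fun o _ => (Real.exp_pos _).le)
    (Finset.mem_univ z.2)

theorem logLoss_zero (D : PMF (X × O)) :
    logLoss D (fun _ _ => 0) = Real.log (Fintype.card O) := by
  simp [logLoss, mean_const]

/-- The effect of a multiplicative update on the logarithmic loss at one point. -/
theorem log_sum_exp_update_le [Nonempty O] (w g : O → ℝ) (h0 : ∀ o, 0 ≤ g o) (h1 : ∀ o, g o ≤ 1)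
    {η : ℝ} (hη0 : 0 ≤ η) (hη1 : η ≤ 1) :
    Real.log (∑ o, Real.exp (w o - η * g o)) ≤
      Real.log (∑ o, Real.exp (w o)) - η * mean (softmax w) g + η ^ 2 := by
  have hZ := sum_exp_pos w
  have hp := sum_toReal (softmax w)
  set p : O → ℝ := fun o => (softmax w o).toReal with hpdef
  have hp0 : ∀ o, 0 ≤ p o := fun o => ENNReal.toReal_nonneg
  have hfac : ∑ o, Real.exp (w o - η * g o) =
      (∑ o, Real.exp (w o)) * ∑ o, p o * Real.exp (-(η * g o)) := by
    rw [Finset.mul_sum]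
    refine Finset.sum_congr rfl fun o _ => ?_
    rw [hpdef]
    simp only
    rw [softmax_toReal, sub_eq_add_neg, Real.exp_add, ← mul_assoc, mul_div_cancel₀ _ hZ.ne']
  have hS : 0 < ∑ o, p o * Real.exp (-(η * g o)) := by
    have := sum_exp_pos fun o => w o - η * g o
    rw [hfac] at this
    exact pos_of_mul_pos_right this hZ.le
  rw [hfac, Real.log_mul hZ.ne' hS.ne']
  -- Uses `exp (-u) ≤ 1 - u + u ^ 2` for `0 ≤ u ≤ 1`, where `u = η * g o ≤ η`.
  have h2 : ∑ o, p o * Real.exp (-(η * g o)) ≤ ∑ o, p o * (1 - η * g o + η ^ 2) := by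
    refine Finset.sum_le_sum fun o _ => mul_le_mul_of_nonneg_left ?_ (hp0 o)
    have hx0 : 0 ≤ η * g o := mul_nonneg hη0 (h0 o)
    have hx1 : η * g o ≤ η := mul_le_of_le_one_right hη0 (h1 o)
    have := (abs_le.1 (Real.abs_exp_sub_one_sub_id_le (x := -(η * g o))
      (by rw [abs_neg, abs_of_nonneg hx0]; linarith))).2
    nlinarith
  have h3 : ∑ o, p o * (1 - η * g o + η ^ 2) = 1 - η * mean (softmax w) g + η ^ 2 := by
    rw [mean_fintype, Finset.mul_sum]
    simp only [mul_add, mul_sub, mul_one, Finset.sum_add_distrib, Finset.sum_sub_distrib, hp,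
      ← Finset.sum_mul, one_mul]
    congr 2
    exact Finset.sum_congr rfl fun o _ => by rw [hpdef]; ring
  have h4 := Real.log_le_sub_one_of_pos hS
  linarith

end Softmax

/-! ### A grid of probability distributions. -/

section Grid

variable {O : Type v} [Fintype O]

theorem exists_discretization [Nonempty O] {M : ℕ} (hM : 0 < M) :
    ∃ (G : Finset (PMF O)) (round : PMF O → G), IsDiscretization G round ∧
      G.card ≤ (M + 1) ^ Fintype.card O ∧
      ∀ f : PMF O, ∑ o, |(f o).toReal - ((round f : PMF O) o).toReal| ≤
        2 * Fintype.card O / M := by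
  classical
  have hM' : (0 : ℝ) < M := by exact_mod_cast hM
  obtain ⟨o₀⟩ := ‹Nonempty O›
  -- The grid consists of the laws with probabilities in `ℤ / M`. Tuples that do not define a law
  -- are sent to a point mass, so that the cardinality bound is immediate.
  set G : Finset (PMF O) := (Finset.univ : Finset (O → Fin (M + 1))).image fun a =>
    if h : ∑ o, ((a o : ℕ) : ℝ) / M = 1 then
      ofReals (fun o => ((a o : ℕ) : ℝ) / M) (fun o => by positivity) h
    else PMF.pure o₀ with hG
  have hcard : G.card ≤ (M + 1) ^ Fintype.card O := Finset.card_image_le.trans (by simp)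
  have happrox : ∀ f : PMF O, ∃ g ∈ G,
      ∑ o, |(f o).toReal - (g o).toReal| ≤ 2 * Fintype.card O / M := by
    intro f
    set b : O → ℕ := fun o => ⌊M * (f o).toReal⌋₊ with hb
    have hbf : ∀ o, (b o : ℝ) ≤ M * (f o).toReal := fun o =>
      Nat.floor_le (mul_nonneg hM'.le ENNReal.toReal_nonneg)
    have hfb : ∀ o, M * (f o).toReal ≤ b o + 1 := fun o => (Nat.lt_floor_add_one _).le
    have hf1 : ∑ o, M * (f o).toReal = M := by rw [← Finset.mul_sum, sum_toReal, mul_one]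
    have hsum : ∑ o ∈ Finset.univ.erase o₀, b o ≤ M := by
      have h : ∑ o ∈ Finset.univ.erase o₀, (b o : ℝ) ≤ M := by
        rw [← hf1]
        exact (Finset.sum_le_sum fun o _ => hbf o).trans
          (Finset.sum_le_sum_of_subset_of_nonneg (Finset.erase_subset _ _)
            fun o _ _ => mul_nonneg hM'.le ENNReal.toReal_nonneg)
      exact_mod_cast h
    -- All coordinates but `o₀` are rounded down, and `o₀` absorbs the missing mass; its error
    -- equals the sum of the other errors, hence the factor `2`.
    set a : O → ℕ := fun o => if o = o₀ then M - ∑ o ∈ Finset.univ.erase o₀, b o else b o with ha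
    have ha_ne : ∀ o ∈ Finset.univ.erase o₀, a o = b o := fun o ho => by
      simp only [ha]; rw [if_neg (Finset.ne_of_mem_erase ho)]
    have ha_sum : ∑ o, a o = M := by
      rw [← Finset.add_sum_erase _ _ (Finset.mem_univ o₀), Finset.sum_congr rfl ha_ne]
      simp only [ha, if_true]
      exact Nat.sub_add_cancel hsum
    have ha_lt : ∀ o, a o < M + 1 := fun o => by
      have := Finset.single_le_sum (f := a) (fun _ _ => Nat.zero_le _) (Finset.mem_univ o)
      omega
    have hsum1 : ∑ o, ((a o : ℕ) : ℝ) / M = 1 := by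
      rw [← Finset.sum_div, ← Nat.cast_sum, ha_sum, div_self hM'.ne']
    have hmem : ofReals (fun o => ((a o : ℕ) : ℝ) / M) (fun o => by positivity) hsum1 ∈ G :=
      Finset.mem_image.2 ⟨fun o => ⟨a o, ha_lt o⟩, Finset.mem_univ _, dif_pos hsum1⟩
    refine ⟨_, hmem, ?_⟩
    simp only [ofReals_toReal]
    have hrest : ∀ o ∈ Finset.univ.erase o₀, |(f o).toReal - (a o : ℝ) / M| =
        (f o).toReal - (a o : ℝ) / M := fun o ho => by
      rw [ha_ne o ho]
      refine abs_of_nonneg (sub_nonneg.2 ?_)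
      rw [div_le_iff₀ hM']
      linarith [hbf o]
    have htot : ∑ o, ((f o).toReal - (a o : ℝ) / M) = 0 := by
      rw [Finset.sum_sub_distrib, hsum1, sum_toReal, sub_self]
    have hle : ∑ o ∈ Finset.univ.erase o₀, ((f o).toReal - (a o : ℝ) / M) ≤
        Fintype.card O / M := by
      have : ∀ o ∈ Finset.univ.erase o₀, (f o).toReal - (a o : ℝ) / M ≤ 1 / M := fun o ho => by
        rw [ha_ne o ho, sub_le_iff_le_add, ← add_div, le_div_iff₀ hM']
        linarith [hfb o]
      refine (Finset.sum_le_sum this).trans ?_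
      rw [Finset.sum_const, nsmul_eq_mul, mul_one_div]
      refine div_le_div_of_nonneg_right ?_ hM'.le
      exact_mod_cast Finset.card_le_univ _
    have hge : 0 ≤ ∑ o ∈ Finset.univ.erase o₀, ((f o).toReal - (a o : ℝ) / M) := by
      rw [← Finset.sum_congr rfl hrest]
      exact Finset.sum_nonneg fun o _ => abs_nonneg _
    rw [← Finset.add_sum_erase _ _ (Finset.mem_univ o₀)] at htot ⊢
    rw [Finset.sum_congr rfl hrest]
    have : (f o₀).toReal - (a o₀ : ℝ) / M =
        -∑ o ∈ Finset.univ.erase o₀, ((f o).toReal - (a o : ℝ) / M) := by linarith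
    rw [this, abs_neg, abs_of_nonneg hge, mul_div_assoc]
    linarith
  have hne : G.Nonempty := by
    obtain ⟨g, hg, -⟩ := happrox (PMF.pure o₀)
    exact ⟨g, hg⟩
  have hmin : ∀ f : PMF O, ∃ g : G, ∀ g' ∈ G, ∑ o, |(f o).toReal - ((g : PMF O) o).toReal| ≤
      ∑ o, |(f o).toReal - (g' o).toReal| := fun f => by
    obtain ⟨g, hg, h⟩ := Finset.exists_min_image G
      (fun g => ∑ o, |(f o).toReal - (g o).toReal|) hne
    exact ⟨⟨g, hg⟩, h⟩
  choose round hround using hmin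
  refine ⟨G, round, fun f g hg => ?_, hcard, fun f => ?_⟩
  · exact mul_le_mul_of_nonneg_left (hround f g hg) (by norm_num)
  · obtain ⟨g, hg, h⟩ := happrox f
    exact (hround f g hg).trans h

end Grid

/-! ### Discrepancies, tests and multi-calibration. -/

section Calibration

variable {X : Type u} {O : Type v} {G : Finset (PMF O)}

open Classical in
/-- The indicator of the event that the outcome `o`, with rounded prediction `g`, lies in `E`. -/
noncomputable def hit (E : Finset (O × G)) (g : G) (o : O) : ℝ := if (o, g) ∈ E then 1 else 0

theorem hit_nonneg (E : Finset (O × G)) (g : G) (o : O) : 0 ≤ hit E g o := by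
  unfold hit; split_ifs <;> norm_num

theorem hit_le_one (E : Finset (O × G)) (g : G) (o : O) : hit E g o ≤ 1 := by
  unfold hit; split_ifs <;> norm_num

/-- The conditional expectation of the label given an individual and its true outcome. -/
noncomputable def gap (round : PMF O → G) (p : X → PMF O) (E : Finset (O × G)) (z : X × O) : ℝ :=
  mean (p z.1) (hit E (round (p z.1))) - hit E (round (p z.1)) z.2

theorem abs_label_le (E : Finset (O × G)) (o' o : O) (g : G) : |label E o' o g| ≤ 1 := by
  change |hit E g o' - hit E g o| ≤ 1
  rw [abs_le]
  constructor <;> linarith [hit_nonneg E g o', hit_nonneg E g o, hit_le_one E g o',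
    hit_le_one E g o]

theorem abs_hit_le (E : Finset (O × G)) (g : G) (o : O) : |hit E g o| ≤ 1 := by
  rw [abs_of_nonneg (hit_nonneg E g o)]; exact hit_le_one E g o

theorem mean_label (round : PMF O → G) (p : X → PMF O) (E : Finset (O × G)) (z : X × O) :
    mean (p z.1) (fun o' => label E o' z.2 (round (p z.1))) = gap round p E z :=
  mean_add_const (fun o _ => abs_hit_le E _ o) (-hit E (round (p z.1)) z.2)

theorem abs_gap_le (round : PMF O → G) (p : X → PMF O) (E : Finset (O × G)) (z : X × O) :
    |gap round p E z| ≤ 1 := by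
  rw [← mean_label]
  exact abs_mean_le fun o _ => abs_label_le E o z.2 _

/-- The restriction of a function of an individual and its outcome to the individuals with
`c = 1`. -/
noncomputable def gate (c : X → Bool) (f : X × O → ℝ) (z : X × O) : ℝ :=
  if c z.1 = true then f z else 0

theorem abs_gate_le (c : X → Bool) {f : X × O → ℝ} {z : X × O} (h : |f z| ≤ 1) :
    |gate c f z| ≤ 1 := by
  unfold gate; split_ifs
  · exact h
  · simp

theorem gate_true (f : X × O → ℝ) : gate (fun _ => true) f = f := by
  funext z; simp [gate]

theorem labeled_support {round : PMF O → G} {D : PMF (X × O)} {p : X → PMF O}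
    {E : Finset (O × G)} {y : X × ℝ} (hy : y ∈ (labeled round D p E).support) :
    y.2 ∈ Set.Icc (-1 : ℝ) 1 := by
  obtain ⟨z, -, hy⟩ := (PMF.mem_support_bind_iff _ _ _).1 hy
  obtain ⟨o, -, rfl⟩ := (PMF.mem_support_map_iff _ _ _).1 hy
  exact abs_le.1 (abs_label_le E o z.2 _)

theorem corr_labeled (round : PMF O → G) (D : PMF (X × O)) (p : X → PMF O) (E : Finset (O × G))
    (c : X → Bool) : corr (labeled round D p E) c = mean D (gate c (gap round p E)) := by
  rw [corr_eq_mean, labeled, mean_bind]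
  · congr 1
    funext z
    rw [mean_map fun o _ => abs_score_le c (abs_le.1 (abs_label_le E o z.2 _))]
    unfold score gate
    split_ifs
    · exact mean_label round p E z
    · exact mean_const _ 0
  · intro z _ y hy
    obtain ⟨o, -, rfl⟩ := (PMF.mem_support_map_iff _ _ _).1 hy
    exact abs_score_le c (abs_le.1 (abs_label_le E o z.2 _))

theorem pr_view (D : PMF (X × O)) (q : X → PMF O) (c : X → Bool) (A : Set (Bool × O × PMF O)) :
    pr (view D c q) A = mean D fun z => A.indicator (1 : Bool × O × PMF O → ℝ) (c z.1, z.2, q z.1) := by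
  have hA : ∀ y, |A.indicator (1 : Bool × O × PMF O → ℝ) y| ≤ 1 := fun y => by
    by_cases hy : y ∈ A <;> simp [hy]
  rw [pr_eq_mean, view, mean_map fun z _ => hA _]

theorem pr_view_modeled [Fintype O] (D : PMF (X × O)) (q : X → PMF O) (c : X → Bool)
    (A : Set (Bool × O × PMF O)) :
    pr (view (modeled D q) c q) A = mean D fun z =>
      ∑ o, (q z.1 o).toReal * A.indicator (1 : Bool × O × PMF O → ℝ) (c z.1, o, q z.1) := by
  have hA : ∀ y, |A.indicator (1 : Bool × O × PMF O → ℝ) y| ≤ 1 := fun y => by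
    by_cases hy : y ∈ A <;> simp [hy]
  rw [pr_eq_mean, view, mean_map fun z _ => hA _, modeled, mean_bind fun z _ y _ => hA _]
  congr 1
  funext z
  rw [mean_map (f := fun y : X × O => A.indicator 1 (c y.1, y.2, q y.1)) fun o _ => hA _,
    mean_fintype]

variable [Fintype X] [Fintype O]

open Classical in
/-- The signed discrepancy between modeled and true outcomes at the outcome `k.1` and the rounded
prediction `k.2`, among the individuals with `c = 1`. -/
noncomputable def disc (round : PMF O → G) (D : PMF (X × O)) (p : X → PMF O) (c : X → Bool)
    (k : O × G) : ℝ :=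
  mean D (gate c fun z => if round (p z.1) = k.2 then
    (p z.1 k.1).toReal - (if z.2 = k.1 then 1 else 0) else 0)

/-- Every linear functional of the discrepancy vector compares modeled with true outcomes through a
test function `a`. Taking `a` constant gives total sum zero, indicators give correlations with
labels, and slices of an event give statistical distance. -/
theorem sum_mul_disc (round : PMF O → G) (D : PMF (X × O)) (p : X → PMF O) (c : X → Bool)
    (a : O × G → ℝ) :
    ∑ k, a k * disc round D p c k = mean D (gate c fun z =>
      ∑ o, (p z.1 o).toReal * a (o, round (p z.1)) - a (z.2, round (p z.1))) := by
  classical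
  simp only [disc, mean_fintype, Finset.mul_sum]
  rw [Finset.sum_comm]
  refine Finset.sum_congr rfl fun z _ => ?_
  simp only [mul_left_comm _ (D z).toReal, ← Finset.mul_sum]
  congr 1
  unfold gate
  split_ifs with hc
  · rw [Fintype.sum_prod_type]
    simp only [mul_ite, mul_zero, Finset.sum_ite_eq, Finset.mem_univ, if_true, mul_sub, mul_one,
      Finset.sum_sub_distrib]
    congr 1
    exact Finset.sum_congr rfl fun o _ => mul_comm _ _
  · simp

theorem sum_disc (round : PMF O → G) (D : PMF (X × O)) (p : X → PMF O) (c : X → Bool) :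
    ∑ k, disc round D p c k = 0 := by
  have := sum_mul_disc round D p c fun _ => 1
  simp only [one_mul, mul_one, sum_toReal, sub_self] at this
  rw [this]
  simp [mean_fintype, gate]

theorem sum_disc_eq (round : PMF O → G) (D : PMF (X × O)) (p : X → PMF O) (c : X → Bool)
    (E : Finset (O × G)) : ∑ k ∈ E, disc round D p c k = mean D (gate c (gap round p E)) := by
  classical
  have := sum_mul_disc round D p c fun k => hit E k.2 k.1
  simp only [hit, Prod.mk.eta, ite_mul, one_mul, zero_mul, Finset.sum_ite_mem,
    Finset.univ_inter] at this
  rw [this]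
  congr 1
  funext z
  unfold gate gap
  rw [mean_fintype]
  rfl

theorem abs_sum_mul_le {κ : Type w} [Fintype κ] {a v : κ → ℝ} (ha : ∀ k, |a k| ≤ 1) :
    |∑ k, a k * v k| ≤ ∑ k, |v k| := by
  refine (Finset.abs_sum_le_sum_abs _ _).trans (Finset.sum_le_sum fun k _ => ?_)
  rw [abs_mul]
  exact mul_le_of_le_one_left (abs_nonneg _) (ha k)

/-- A predictor with small discrepancies is multi-calibrated after rounding. -/
theorem multiCalibrated_of_disc_le {round : PMF O → G} {D : PMF (X × O)} {p : X → PMF O}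
    {C : Finset (X → Bool)} {ε : ℝ}
    (hround : ∀ f : PMF O, ∑ o, |(f o).toReal - ((round f : PMF O) o).toReal| ≤ ε / 2)
    (hC : ∀ c ∈ C, ∑ k, |disc round D p c k| ≤ ε / 8)
    (h1 : ∑ k, |disc round D p (fun _ => true) k| ≤ ε / 8) :
    MultiCalibrated C ε D fun x => (round (p x) : PMF O) := by
  intro c hc
  have hcε := hC c hc
  have hε : 0 ≤ ε := by
    have := (Finset.sum_nonneg fun k _ => abs_nonneg _).trans h1
    linarith
  refine ciSup_le fun A => ?_
  set q : X → PMF O := fun x => (round (p x) : PMF O) with hq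
  -- The rounded predictor takes values in `G`, so only these two slices of `A` matter.
  set a : Bool → O × G → ℝ := fun b k => A.indicator 1 (b, k.1, (k.2 : PMF O)) with ha
  have ha1 : ∀ b k, |a b k| ≤ 1 := fun b k => by
    by_cases hy : (b, k.1, (k.2 : PMF O)) ∈ A <;> simp [ha, hy]
  set r : X × O → ℝ := fun z =>
    ∑ o, ((q z.1 o).toReal - (p z.1 o).toReal) * a (c z.1) (o, round (p z.1)) with hr
  set s : X × O → ℝ := fun z =>
    ∑ o, (p z.1 o).toReal * a (c z.1) (o, round (p z.1)) - a (c z.1) (z.2, round (p z.1)) with hs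
  have hsplit : pr (view (modeled D q) c q) A - pr (view D c q) A = mean D r + mean D s := by
    rw [pr_view_modeled, pr_view]
    simp only [mean_fintype, ← Finset.sum_sub_distrib, ← Finset.sum_add_distrib, ← mul_sub,
      ← mul_add]
    refine Finset.sum_congr rfl fun z _ => ?_
    congr 1
    simp only [hr, hs, sub_mul, Finset.sum_sub_distrib, sub_add_sub_cancel]
    rfl
  have hrle : |mean D r| ≤ ε / 2 := by
    refine abs_mean_le fun z _ => ?_
    refine le_trans ?_ (hround (p z.1))
    refine (Finset.abs_sum_le_sum_abs _ _).trans (Finset.sum_le_sum fun o _ => ?_)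
    rw [abs_mul, abs_sub_comm]
    exact mul_le_of_le_one_right (abs_nonneg _) (ha1 _ _)
  -- The slice with `c = 0` is handled by writing the indicator of `c = 0` as `1 - c`. The three
  -- sums cost `3 * ε / 8`, which together with the rounding error `ε / 2` stays below `ε`.
  have hsle : mean D s = ∑ k, a true k * disc round D p c k +
      ∑ k, a false k * disc round D p (fun _ => true) k - ∑ k, a false k * disc round D p c k := by
    simp only [sum_mul_disc, mean_fintype, ← Finset.sum_sub_distrib, ← Finset.sum_add_distrib,
      ← mul_sub, ← mul_add]
    refine Finset.sum_congr rfl fun z _ => ?_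
    congr 1
    simp only [hs, gate]
    cases c z.1 <;> simp
  have b1 := abs_le.1 ((abs_sum_mul_le (ha1 true)).trans hcε)
  have b2 := abs_le.1 ((abs_sum_mul_le (ha1 false)).trans h1)
  have b3 := abs_le.1 ((abs_sum_mul_le (ha1 false)).trans hcε)
  have b4 := abs_le.1 hrle
  rw [hsplit, hsle, abs_le]
  constructor <;> linarith [b1.1, b1.2, b2.1, b2.2, b3.1, b3.2, b4.1, b4.2]

open Classical in
/-- The sets `E` for which some function of `C`, or the constant function `1`, has correlation
above `θ` with the labels. -/
noncomputable def goodSets (round : PMF O → G) (D : PMF (X × O)) (p : X → PMF O)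
    (C : Finset (X → Bool)) (θ : ℝ) : Finset (Finset (O × G)) :=
  Finset.univ.filter fun E =>
    (∃ c ∈ C, θ < corr (labeled round D p E) c) ∨ θ < mean D (gap round p E)

/-- If rounding `p` does not give a multi-calibrated predictor, then a random `E` reveals this
with probability at least `1 / 10`. -/
theorem two_pow_le_card_goodSets {round : PMF O → G} {D : PMF (X × O)} {p : X → PMF O}
    {C : Finset (X → Bool)} {ε : ℝ} (hε : 0 < ε)
    (hround : ∀ f : PMF O, ∑ o, |(f o).toReal - ((round f : PMF O) o).toReal| ≤ ε / 2)
    (h : ¬ MultiCalibrated C ε D fun x => (round (p x) : PMF O)) :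
    (2 : ℝ) ^ Fintype.card (O × G) ≤
      10 * (goodSets round D p C (ε / (32 * Real.sqrt (Fintype.card (O × G))))).card := by
  classical
  have hθ : ε / (32 * Real.sqrt (Fintype.card (O × G))) =
      ε / 8 / (4 * Real.sqrt (Fintype.card (O × G))) := by
    rw [div_div]; congr 1; ring
  have key : ∀ c : X → Bool, ε / 8 < ∑ k, |disc round D p c k| → (c ∈ C ∨ c = fun _ => true) →
      (2 : ℝ) ^ Fintype.card (O × G) ≤
        10 * (goodSets round D p C (ε / (32 * Real.sqrt (Fintype.card (O × G))))).card := by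
    intro c hc hcC
    refine (two_pow_le_card_large_sum (sum_disc round D p c) (by positivity) hc).trans ?_
    refine mul_le_mul_of_nonneg_left (Nat.cast_le.2 (Finset.card_le_card ?_)) (by norm_num)
    intro E hE
    have hE' := (Finset.mem_filter.1 hE).2
    rw [sum_disc_eq, ← hθ] at hE'
    refine Finset.mem_filter.2 ⟨Finset.mem_univ _, ?_⟩
    rcases hcC with hcC | rfl
    · exact Or.inl ⟨c, hcC, by rwa [corr_labeled]⟩
    · rw [gate_true] at hE'
      exact Or.inr hE'
  by_contra hcon
  refine h (multiCalibrated_of_disc_le hround (fun c hc => ?_) ?_)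
  · by_contra hlt
    exact hcon (key c (not_le.1 hlt) (Or.inl hc))
  · by_contra hlt
    exact hcon (key _ (not_le.1 hlt) (Or.inr rfl))

end Calibration

/-! ### Sample counts and repeated sampling. -/

theorem Algorithm.UsesAtMost.mono {X : Type u} {O : Type v} {G : Finset (PMF O)}
    {alg : Algorithm X O G} {n m : ℕ} (h : alg.UsesAtMost n) (hnm : n ≤ m) : alg.UsesAtMost m := by
  induction alg generalizing n m with
  | output p => trivial
  | draw μ k ih => exact fun a => ih a (h a) hnm
  | sample k ih =>
    exact ⟨h.1.trans hnm, fun z => ih z (h.2 z) (Nat.sub_le_sub_right hnm 1)⟩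
  | test θ p T k ih =>
    exact ⟨h.1.trans hnm, fun E r => ih E r (h.2 E r) (Nat.sub_le_sub_right hnm T)⟩

/-- Draw `n` fresh pairs and continue with their list. -/
def Algorithm.collect {X : Type u} {O : Type v} {G : Finset (PMF O)} :
    ℕ → (List (X × O) → Algorithm X O G) → Algorithm X O G
  | 0, k => k []
  | n + 1, k => .sample fun z => collect n fun l => k (z :: l)

theorem Algorithm.run_collect {X : Type u} {O : Type v} [Fintype O] {G : Finset (PMF O)}
    (round : PMF O → G) (W : Learner X) (D : PMF (X × O)) (n : ℕ)
    (k : List (X × O) → Algorithm X O G) :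
    (collect n k).run round W D = (iidList D n).bind fun l => (k l).run round W D := by
  induction n generalizing k with
  | zero => rw [collect, iidList, PMF.pure_bind]
  | succ n ih =>
    rw [collect, iidList, Algorithm.run, PMF.bind_bind]
    congr 1
    funext z
    rw [ih, PMF.bind_map]
    rfl

theorem Algorithm.usesAtMost_collect {X : Type u} {O : Type v} {G : Finset (PMF O)} {n m : ℕ}
    {k : List (X × O) → Algorithm X O G} (h : ∀ l, (k l).UsesAtMost m) :
    (collect n k).UsesAtMost (n + m) := by
  induction n generalizing k with
  | zero => simpa [collect] using h []
  | succ n ih =>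
    refine ⟨by omega, fun z => ?_⟩
    rw [show n + 1 + m - 1 = n + m by omega]
    exact ih fun l => h (z :: l)

/-! ### The boosting algorithm and its potential argument. -/

section Boosting

variable {X : Type u} {O : Type v} [Fintype X] [Fintype O] [Nonempty O] {G : Finset (PMF O)}

/-- The multiplicative update that lowers the probability of `E` where `c = 1`. -/
noncomputable def update (round : PMF O → G) (η : ℝ) (w : X → O → ℝ) (E : Finset (O × G))
    (c : X → Bool) : X → O → ℝ :=
  fun x o => w x o - η * (if c x = true then hit E (round (softmax (w x))) o else 0)

/-- The pointwise bound `log_sum_exp_update_le`, averaged: the first-order gain is the modeled minus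
the true frequency of `E` where `c = 1`, which is the correlation of `c` with the labels. -/
theorem logLoss_update_le (round : PMF O → G) (D : PMF (X × O)) {η : ℝ} (hη0 : 0 ≤ η)
    (hη1 : η ≤ 1) (w : X → O → ℝ) (E : Finset (O × G)) (c : X → Bool) :
    logLoss D (update round η w E c) ≤
      logLoss D w - η * mean D (gate c (gap round (fun x => softmax (w x)) E)) + η ^ 2 := by
  have hpoint : ∀ z : X × O,
      Real.log (∑ o, Real.exp (update round η w E c z.1 o)) - update round η w E c z.1 z.2 ≤
        (Real.log (∑ o, Real.exp (w z.1 o)) - w z.1 z.2) -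
          η * gate c (gap round (fun x => softmax (w x)) E) z + η ^ 2 := by
    intro z
    set g : O → ℝ := fun o => if c z.1 = true then hit E (round (softmax (w z.1))) o else 0 with hg
    have h := log_sum_exp_update_le (w z.1) g
      (fun o => by simp only [hg]; split_ifs; exacts [hit_nonneg _ _ _, le_rfl])
      (fun o => by simp only [hg]; split_ifs; exacts [hit_le_one _ _ _, zero_le_one]) hη0 hη1
    have hgate : gate c (gap round (fun x => softmax (w x)) E) z =
        mean (softmax (w z.1)) g - g z.2 := by
      unfold gate gap
      simp only [hg]
      split_ifs
      · rfl
      · simp [mean_const]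
    have hu : ∀ o, update round η w E c z.1 o = w z.1 o - η * g o := fun o => rfl
    simp only [hu, hgate]
    linarith
  have hsum : logLoss D w - η * mean D (gate c (gap round (fun x => softmax (w x)) E)) + η ^ 2 =
      mean D fun z => (Real.log (∑ o, Real.exp (w z.1 o)) - w z.1 z.2) -
          η * gate c (gap round (fun x => softmax (w x)) E) z + η ^ 2 := by
    rw [← mean_const_mul, logLoss]
    simp only [mean_fintype, mul_add, mul_sub, Finset.sum_add_distrib, Finset.sum_sub_distrib,
      ← Finset.sum_mul, sum_toReal, one_mul]
  rw [hsum, logLoss, mean_fintype, mean_fintype]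
  exact Finset.sum_le_sum fun z _ => mul_le_mul_of_nonneg_left (hpoint z) ENNReal.toReal_nonneg

open Classical in
/-- The state after a test with the set `E` and answer `r` and a sample `l`: the answer of the
learner is used if there is one, and otherwise the constant function `1` if it has empirical
correlation above `3 / 4 * θ`. -/
noncomputable def next (round : PMF O → G) (θ : ℝ) (w : X → O → ℝ) (E : Finset (O × G))
    (r : Option (X → Bool)) (l : List (X × O)) : X → O → ℝ :=
  match r with
  | some c => update round (θ / 4) w E c
  | none =>
    if 3 / 4 * θ * l.length < (l.map (gap round (fun x => softmax (w x)) E)).sum then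
      update round (θ / 4) w E fun _ => true
    else w

/-- `t` rounds of testing and updating, followed by the output of the rounded predictor. -/
noncomputable def boost (round : PMF O → G) (θ : ℝ) (T S : ℕ) :
    ℕ → (X → O → ℝ) → Algorithm X O G
  | 0, w => .output fun x => (round (softmax (w x)) : PMF O)
  | t + 1, w => .test θ (fun x => softmax (w x)) T fun E r =>
      Algorithm.collect S fun l => boost round θ T S t (next round θ w E r l)

omit [Fintype X] in
theorem usesAtMost_boost (round : PMF O → G) (θ : ℝ) (T S t : ℕ) (w : X → O → ℝ) :
    (boost round θ T S t w).UsesAtMost (t * (T + S)) := by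
  induction t generalizing w with
  | zero => trivial
  | succ t ih =>
    have e : (t + 1) * (T + S) = T + (S + t * (T + S)) := by ring
    refine ⟨by omega, fun E r => ?_⟩
    rw [e, Nat.add_sub_cancel_left]
    exact Algorithm.usesAtMost_collect fun l => ih _

/-- The law of the state after one round. -/
noncomputable def roundLaw (round : PMF O → G) (W : Learner X) (D : PMF (X × O)) (θ : ℝ) (T S : ℕ)
    (w : X → O → ℝ) : PMF (X → O → ℝ) :=
  (PMF.uniformOfFintype (Finset (O × G))).bind fun E =>
    (learn W θ (labeled round D (fun x => softmax (w x)) E) T).bind fun r =>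
      (iidList D S).map fun l => next round θ w E r l

omit [Fintype X] in
theorem run_boost_succ (round : PMF O → G) (W : Learner X) (D : PMF (X × O)) (θ : ℝ) (T S t : ℕ)
    (w : X → O → ℝ) : (boost round θ T S (t + 1) w).run round W D =
      (roundLaw round W D θ T S w).bind fun w' => (boost round θ T S t w').run round W D := by
  rw [boost, Algorithm.run, roundLaw, PMF.bind_bind]
  simp only [PMF.bind_bind, PMF.bind_map, Algorithm.run_collect]
  rfl

open Classical in
/-- The answers that a weak agnostic learner is supposed to give. -/
noncomputable def validAnswers (C : Finset (X → Bool)) (P : PMF (X × ℝ)) (θ : ℝ) :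
    Set (Option (X → Bool)) :=
  if ∃ c ∈ C, θ < corr P c then Found C P θ else Found C P θ ∪ {none}

omit [Fintype X] in
theorem toOuterMeasure_validAnswers_compl_le {W : Learner X} {C : Finset (X → Bool)}
    {P : PMF (X × ℝ)} {θ β : ℝ} {T : ℕ} (hβ : 0 ≤ β) (h : WeakAgnostic W C P θ β T) :
    (learn W θ P T).toOuterMeasure (validAnswers C P θ)ᶜ ≤ ENNReal.ofReal β := by
  rw [← one_sub_le_pr_iff hβ, validAnswers]
  split_ifs with hex
  · exact h.1 hex
  · push Not at hex
    exact h.2 hex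

/-- Even a wrong update with step `θ / 4` costs at most `θ / 4 + θ ^ 2 / 16`, since correlations are
at least `-1`. -/
theorem logLoss_next_le (round : PMF O → G) (D : PMF (X × O)) {θ : ℝ} (hθ : 0 < θ) (hθ1 : θ < 1)
    (w : X → O → ℝ) (E : Finset (O × G)) (r : Option (X → Bool)) (l : List (X × O)) :
    logLoss D (next round θ w E r l) ≤ logLoss D w + θ := by
  have hupd : ∀ c, logLoss D (update round (θ / 4) w E c) ≤ logLoss D w + θ := by
    intro c
    refine (logLoss_update_le round D (by linarith) (by linarith) w E c).trans ?_
    have := (abs_le.1 (abs_mean_le (μ := D) fun z _ =>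
      abs_gate_le c (abs_gap_le round (fun x => softmax (w x)) E z))).1
    nlinarith
  unfold next
  split
  · exact hupd _
  · split_ifs
    · exact hupd _
    · linarith

-- When learner and estimate are both accurate, every update uses a correlation above `θ / 2`, and
-- the step `θ / 4` gains `θ / 4 * (θ / 2) - (θ / 4) ^ 2 = θ ^ 2 / 16`. If the valid answer is `⊥`,
-- no function of `C` exceeds `θ`, so a good `E` must be revealed by the constant `1`, and the
-- empirical check detects it.
open Classical in
theorem logLoss_next_add_le (round : PMF O → G) (D : PMF (X × O)) {θ : ℝ} (hθ : 0 < θ)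
    (hθ1 : θ < 1) (w : X → O → ℝ) (C : Finset (X → Bool)) (E : Finset (O × G))
    {r : Option (X → Bool)} {l : List (X × O)}
    (hr : r ∈ validAnswers C (labeled round D (fun x => softmax (w x)) E) θ)
    (hl : |l.length * mean D (gap round (fun x => softmax (w x)) E) -
      (l.map (gap round (fun x => softmax (w x)) E)).sum| < l.length * (θ / 4)) :
    logLoss D (next round θ w E r l) +
      (if E ∈ goodSets round D (fun x => softmax (w x)) C θ then θ ^ 2 / 16 else 0) ≤
        logLoss D w := by
  set p : X → PMF O := fun x => softmax (w x) with hp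
  have hite : (if E ∈ goodSets round D p C θ then θ ^ 2 / 16 else 0) ≤ θ ^ 2 / 16 := by
    split_ifs
    · exact le_rfl
    · positivity
  have hupd : ∀ c, θ / 2 < mean D (gate c (gap round p E)) →
      logLoss D (update round (θ / 4) w E c) +
        (if E ∈ goodSets round D p C θ then θ ^ 2 / 16 else 0) ≤ logLoss D w := by
    intro c hc
    have := logLoss_update_le round D (η := θ / 4) (by linarith) (by linarith) w E c
    change _ ≤ _ - θ / 4 * mean D (gate c (gap round p E)) + _ at this
    nlinarith
  have hlen : (0 : ℝ) < l.length :=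
    pos_of_mul_pos_left ((abs_nonneg _).trans_lt hl) (by linarith)
  obtain ⟨hl1, hl2⟩ := abs_lt.1 hl
  cases r with
  | some c =>
    have hfound : some c ∈ Found C (labeled round D p E) θ := by
      unfold validAnswers at hr
      split_ifs at hr
      · exact hr
      · simpa using hr
    obtain ⟨c', -, hc', hcorr⟩ := hfound
    rw [← Option.some_inj.1 hc', corr_labeled] at hcorr
    exact hupd c hcorr
  | none =>
    unfold validAnswers at hr
    split_ifs at hr with hex
    · obtain ⟨c', -, hc', -⟩ := hr
      exact absurd hc' (by simp)
    · unfold next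
      simp only
      split_ifs with h1 h2 h2
      · have := hupd (fun _ => true) (by
          rw [gate_true]
          refine lt_of_mul_lt_mul_left ?_ hlen.le
          linarith)
        rwa [if_pos h2] at this
      · have := hupd (fun _ => true) (by
          rw [gate_true]
          refine lt_of_mul_lt_mul_left ?_ hlen.le
          linarith)
        rwa [if_neg h2] at this
      · exfalso
        have h3 := (Finset.mem_filter.1 h2).2.resolve_left hex
        have h4 := mul_lt_mul_of_pos_left h3 hlen
        exact h1 (by linarith)
      · simp

/-- The expected change of the logarithmic loss in one round. -/
theorem ex_logLoss_roundLaw_le {round : PMF O → G} {W : Learner X} {D : PMF (X × O)} {θ β : ℝ}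
    {T S : ℕ} {C : Finset (X → Bool)} (hθ : 0 < θ) (hθ1 : θ < 1) (hβ : 0 ≤ β) (w : X → O → ℝ)
    (hW : ∀ E, WeakAgnostic W C (labeled round D (fun x => softmax (w x)) E) θ β T)
    (hS : 2 * Real.exp (-(S * (θ / 4) ^ 2 / 8)) ≤ β) :
    ex (roundLaw round W D θ T S w) (fun w' => ENNReal.ofReal (logLoss D w')) +
      ENNReal.ofReal (θ ^ 2 / 16) * (PMF.uniformOfFintype (Finset (O × G))).toOuterMeasure
        (goodSets round D (fun x => softmax (w x)) C θ) ≤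
      ENNReal.ofReal (logLoss D w) + ENNReal.ofReal (4 * θ * β) := by
  classical
  set p : X → PMF O := fun x => softmax (w x) with hp
  set L : Finset (O × G) → Set (List (X × O)) := fun E =>
    {l | S * (θ / 4) ≤ |S * mean D (gap round p E) - (l.map (gap round p E)).sum|} with hL
  set R : Finset (O × G) → Set (Option (X → Bool)) := fun E =>
    (validAnswers C (labeled round D p E) θ)ᶜ with hR
  -- A failure of the learner or of the estimate is charged `2 * θ`: at most `θ` for the increase of
  -- the loss and at most `θ` for the missing gain.
  have hpoint : ∀ E r, ∀ l ∈ (iidList D S).support,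
      ENNReal.ofReal (logLoss D (next round θ w E r l)) +
        ENNReal.ofReal (θ ^ 2 / 16) * (goodSets round D p C θ : Set _).indicator 1 E ≤
      ENNReal.ofReal (logLoss D w) +
        ENNReal.ofReal (2 * θ) * ((R E).indicator 1 r + (L E).indicator 1 l) := by
    intro E r l hl
    have hlen := (mem_support_iidList hl).1
    have e : ENNReal.ofReal (logLoss D (next round θ w E r l)) +
        ENNReal.ofReal (θ ^ 2 / 16) * (goodSets round D p C θ : Set _).indicator 1 E =
        ENNReal.ofReal (logLoss D (next round θ w E r l) +
          if E ∈ goodSets round D p C θ then θ ^ 2 / 16 else 0) := by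
      rw [ENNReal.ofReal_add (logLoss_nonneg _ _) (by split_ifs <;> positivity)]
      congr 1
      by_cases h : E ∈ goodSets round D p C θ <;> simp [h]
    rw [e]
    by_cases hfail : r ∈ R E ∨ l ∈ L E
    · have h1 : (1 : ℝ≥0∞) ≤ (R E).indicator 1 r + (L E).indicator 1 l := by
        rcases hfail with h | h <;> simp [h]
      refine le_trans ?_ (add_le_add_right (mul_le_mul_right h1 _) _)
      rw [mul_one, ← ENNReal.ofReal_add (logLoss_nonneg _ _) (by linarith)]
      refine ENNReal.ofReal_le_ofReal ?_
      have h2 := logLoss_next_le round D hθ hθ1 w E r l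
      have h3 : (if E ∈ goodSets round D p C θ then θ ^ 2 / 16 else 0) ≤ θ := by
        split_ifs
        · nlinarith
        · exact hθ.le
      linarith
    · push Not at hfail
      refine le_trans (ENNReal.ofReal_le_ofReal ?_) le_self_add
      refine logLoss_next_add_le round D hθ hθ1 w C E (not_not.1 hfail.1) ?_
      rw [hlen]
      exact not_le.1 hfail.2
  have hinner : ∀ E, (ex (learn W θ (labeled round D p E) T) fun r => ex (iidList D S) fun l =>
      ENNReal.ofReal (logLoss D (next round θ w E r l))) +
        ENNReal.ofReal (θ ^ 2 / 16) * (goodSets round D p C θ : Set _).indicator 1 E ≤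
      ENNReal.ofReal (logLoss D w) + ENNReal.ofReal (4 * θ * β) := by
    intro E
    have h1 : (ex (learn W θ (labeled round D p E) T) fun r => ex (iidList D S) fun l =>
        ENNReal.ofReal (logLoss D (next round θ w E r l)) +
        ENNReal.ofReal (θ ^ 2 / 16) * (goodSets round D p C θ : Set _).indicator 1 E) ≤
        ex (learn W θ (labeled round D p E) T) fun r => ex (iidList D S) fun l =>
          ENNReal.ofReal (logLoss D w) +
            ENNReal.ofReal (2 * θ) * ((R E).indicator 1 r + (L E).indicator 1 l) :=
      ex_mono fun r => ex_mono_of_support fun l hl => hpoint E r l hl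
    simp only [ex_add, ex_const, ex_mul_left] at h1
    refine h1.trans (add_le_add_right ?_ _)
    rw [← toOuterMeasure_eq_ex, ← toOuterMeasure_eq_ex]
    have h2 := toOuterMeasure_validAnswers_compl_le hβ (hW E)
    have h3 := (single_deviation (P := D) (fun z _ => abs_gap_le round p E z) S
      (t := θ / 4) (by linarith)).trans (ENNReal.ofReal_le_ofReal hS)
    refine (mul_le_mul_right (add_le_add h2 h3) _).trans ?_
    rw [← ENNReal.ofReal_add hβ hβ, ← ENNReal.ofReal_mul (by linarith)]
    exact ENNReal.ofReal_le_ofReal (by linarith)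
  have hfinal := ex_mono (μ := PMF.uniformOfFintype (Finset (O × G))) hinner
  rw [ex_add, ex_const, ex_mul_left, ← toOuterMeasure_eq_ex] at hfinal
  rw [roundLaw, ex_bind]
  simp only [ex_bind, ex_map]
  exact hfinal

theorem one_tenth_le_goodSets {round : PMF O → G} {D : PMF (X × O)} {p : X → PMF O}
    {C : Finset (X → Bool)} {ε : ℝ} (hε : 0 < ε)
    (hround : ∀ f : PMF O, ∑ o, |(f o).toReal - ((round f : PMF O) o).toReal| ≤ ε / 2)
    (h : ¬ MultiCalibrated C ε D fun x => (round (p x) : PMF O)) :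
    ENNReal.ofReal (1 / 10) ≤ (PMF.uniformOfFintype (Finset (O × G))).toOuterMeasure
      (goodSets round D p C (ε / (32 * Real.sqrt (Fintype.card (O × G))))) := by
  classical
  have hcard := two_pow_le_card_goodSets hε hround h
  rw [PMF.toOuterMeasure_apply_finset]
  simp only [PMF.uniformOfFintype_apply, Finset.sum_const, nsmul_eq_mul, Fintype.card_finset]
  rw [← div_eq_mul_inv, ENNReal.le_div_iff_mul_le (by simp) (by simp)]
  rw [← ENNReal.ofReal_natCast, ← ENNReal.ofReal_natCast, ← ENNReal.ofReal_mul (by norm_num)]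
  refine ENNReal.ofReal_le_ofReal ?_
  push_cast
  linarith

/-- The number of rounds after which the current predictor is bad, in expectation. -/
theorem sum_bad_le {round : PMF O → G} {W : Learner X} {D : PMF (X × O)} {ε θ β : ℝ}
    {T S : ℕ} {C : Finset (X → Bool)} (hε : 0 < ε)
    (hround : ∀ f : PMF O, ∑ o, |(f o).toReal - ((round f : PMF O) o).toReal| ≤ ε / 2)
    (hθ : 0 < θ) (hθ1 : θ < 1) (hθε : θ = ε / (32 * Real.sqrt (Fintype.card (O × G))))
    (hβ : 0 ≤ β)
    (hW : ∀ p E, WeakAgnostic W C (labeled round D p E) θ β T)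
    (hS : 2 * Real.exp (-(S * (θ / 4) ^ 2 / 8)) ≤ β) (B : ℕ) (w : X → O → ℝ) :
    ENNReal.ofReal (θ ^ 2 / 160) * ∑ t ∈ Finset.range B,
      ((boost round θ T S t w).run round W D).toOuterMeasure {p | MultiCalibrated C ε D p}ᶜ ≤
      ENNReal.ofReal (logLoss D w) + B * ENNReal.ofReal (4 * θ * β) := by
  induction B generalizing w with
  | zero => simp
  | succ B ih =>
    have hstep := ex_logLoss_roundLaw_le hθ hθ1 hβ w (hW fun x => softmax (w x)) hS
    -- The term `t = 0` concerns the present predictor and is paid for by the gain of the first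
    -- round; the later terms are those of a run from the state after this round.
    rw [Finset.sum_range_succ']
    simp only [run_boost_succ, toOuterMeasure_bind]
    rw [← ex_finset_sum, mul_add, ← ex_mul_left]
    have h1 := ex_mono (μ := roundLaw round W D θ T S w) ih
    rw [ex_add, ex_const] at h1
    have h0 : ENNReal.ofReal (θ ^ 2 / 160) * ((boost round θ T S 0 w).run round W D).toOuterMeasure
        {p | MultiCalibrated C ε D p}ᶜ ≤
        ENNReal.ofReal (θ ^ 2 / 16) * (PMF.uniformOfFintype (Finset (O × G))).toOuterMeasure
          (goodSets round D (fun x => softmax (w x)) C θ) := by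
      rw [boost, Algorithm.run]
      by_cases hcal : MultiCalibrated C ε D fun x => (round (softmax (w x)) : PMF O)
      · simp [PMF.toOuterMeasure_pure_apply, hcal]
      · have := one_tenth_le_goodSets hε hround hcal
        rw [← hθε] at this
        refine le_trans ?_ (mul_le_mul_right this _)
        rw [← ENNReal.ofReal_mul (by positivity)]
        refine (mul_le_mul_right (toOuterMeasure_le_one _ _) _).trans ?_
        rw [mul_one]
        exact ENNReal.ofReal_le_ofReal (by linarith)
    calc _ ≤ (ex (roundLaw round W D θ T S w) (fun w' => ENNReal.ofReal (logLoss D w')) +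
            B * ENNReal.ofReal (4 * θ * β)) +
          ENNReal.ofReal (θ ^ 2 / 16) * (PMF.uniformOfFintype (Finset (O × G))).toOuterMeasure
          (goodSets round D (fun x => softmax (w x)) C θ) := add_le_add h1 h0
      _ = (ex (roundLaw round W D θ T S w) (fun w' => ENNReal.ofReal (logLoss D w')) +
          ENNReal.ofReal (θ ^ 2 / 16) * (PMF.uniformOfFintype (Finset (O × G))).toOuterMeasure
          (goodSets round D (fun x => softmax (w x)) C θ)) + B * ENNReal.ofReal (4 * θ * β) := by
            ring
      _ ≤ ENNReal.ofReal (logLoss D w) + ENNReal.ofReal (4 * θ * β) +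
          B * ENNReal.ofReal (4 * θ * β) := add_le_add_left hstep _
      _ = _ := by push_cast; ring

/-- Boosting for a random number of rounds less than `B`. -/
noncomputable def boostRandomly (round : PMF O → G) (θ : ℝ) (T S B : ℕ) (hB : 0 < B) :
    Algorithm X O G :=
  .draw (PMF.uniformOfFinset (Finset.range B) (Finset.nonempty_range_iff.2 hB.ne')) fun a =>
    -- The cap `B` has no effect on the support of the draw, but the sample bound quantifies over
    -- all natural numbers `a`.
    boost round θ T S (min a B) fun _ _ => 0

omit [Fintype X] in
theorem usesAtMost_boostRandomly (round : PMF O → G) (θ : ℝ) (T S B : ℕ) (hB : 0 < B) :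
    (boostRandomly (X := X) round θ T S B hB).UsesAtMost (B * (T + S)) := fun _ =>
  (usesAtMost_boost round θ T S _ _).mono (Nat.mul_le_mul_right _ (min_le_right _ _))

theorem boostRandomly_spec {round : PMF O → G} {W : Learner X} {D : PMF (X × O)} {ε θ β : ℝ}
    {T S B : ℕ} {C : Finset (X → Bool)} (hε : 0 < ε)
    (hround : ∀ f : PMF O, ∑ o, |(f o).toReal - ((round f : PMF O) o).toReal| ≤ ε / 2)
    (hθ : 0 < θ) (hθ1 : θ < 1) (hθε : θ = ε / (32 * Real.sqrt (Fintype.card (O × G))))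
    (hβ : β = θ / 12800)
    (hW : ∀ p E, WeakAgnostic W C (labeled round D p E) θ β T)
    (hS : 2 * Real.exp (-(S * (θ / 4) ^ 2 / 8)) ≤ β) (hB : 0 < B)
    (hBℓ : 3200 * Fintype.card O / θ ^ 2 ≤ B) :
    (9 / 10 : ℝ) ≤ pr ((boostRandomly round θ T S B hB).run round W D)
      {p | MultiCalibrated C ε D p} := by
  have hβ0 : 0 ≤ β := by rw [hβ]; positivity
  rw [show (9 / 10 : ℝ) = 1 - 1 / 10 by norm_num, one_sub_le_pr_iff (by norm_num)]
  have hsum := sum_bad_le hε hround hθ hθ1 hθε hβ0 hW hS B fun _ _ => 0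
  set b : ℕ → ℝ≥0∞ := fun t => ((boost round θ T S t fun _ _ => 0).run round W D).toOuterMeasure
    {p | MultiCalibrated C ε D p}ᶜ with hb
  have hrun : ((boostRandomly round θ T S B hB).run round W D).toOuterMeasure
      {p | MultiCalibrated C ε D p}ᶜ = (B : ℝ≥0∞)⁻¹ * ∑ t ∈ Finset.range B, b t := by
    rw [boostRandomly, Algorithm.run, toOuterMeasure_bind, ex, Finset.mul_sum,
      tsum_eq_sum (s := Finset.range B)]
    · refine Finset.sum_congr rfl fun t ht => ?_
      rw [PMF.uniformOfFinset_apply_of_mem _ ht, Finset.card_range,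
        min_eq_left (Finset.mem_range.1 ht).le]
    · intro t ht
      rw [PMF.uniformOfFinset_apply_of_notMem _ ht, zero_mul]
  have hB' : (0 : ℝ) < B := by exact_mod_cast hB
  rw [hrun]
  rw [logLoss_zero, ← ENNReal.ofReal_natCast, ← ENNReal.ofReal_mul hB'.le,
    ← ENNReal.ofReal_add (Real.log_natCast_nonneg _) (by positivity)] at hsum
  -- The constants `3200` and `12800` make each of the two terms on the left at most `B * θ ^ 2 /
  -- 3200`, half of the right side.
  have hbound : Real.log (Fintype.card O) + B * (4 * θ * β) ≤ θ ^ 2 / 160 * (B * (1 / 10)) := by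
    have h1 : Real.log (Fintype.card O) ≤ Fintype.card O :=
      Real.log_le_self (Nat.cast_nonneg _)
    rw [div_le_iff₀ (by positivity)] at hBℓ
    rw [hβ]
    nlinarith
  have h2 := hsum.trans (ENNReal.ofReal_le_ofReal hbound)
  rw [ENNReal.ofReal_mul (by positivity)] at h2
  have h3 := (ENNReal.mul_le_mul_iff_right (ENNReal.ofReal_pos.2 (by positivity)).ne'
    ENNReal.ofReal_ne_top).1 h2
  rw [ENNReal.ofReal_mul hB'.le, ENNReal.ofReal_natCast] at h3
  rw [mul_comm, ← div_eq_mul_inv]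
  exact ENNReal.div_le_of_le_mul' h3

end Boosting

/-! ### Choice of parameters and sample complexity. -/

theorem statDist_le_one {Z : Type w} (μ ν : PMF Z) : statDist μ ν ≤ 1 := by
  refine ciSup_le fun A => ?_
  have h0 : ∀ ρ : PMF Z, 0 ≤ pr ρ A := fun ρ => ENNReal.toReal_nonneg
  rw [abs_le]
  constructor <;> linarith [h0 μ, h0 ν, pr_le_one μ A, pr_le_one ν A]

/-- The constant `25600 * 1024` is below `6 ^ 10 ≤ x ^ 10`, so the logarithm is at most `(ℓ + 13) *
log x`, and `13 ≤ 3 * x`. -/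
theorem log_two_div_le {ℓ θ x : ℝ} {m : ℕ} (hx : 6 ≤ x) (hθ : 0 < θ) (hθ1 : θ < 1)
    (hℓx : ℓ ≤ x) (hm : (m : ℝ) = ℓ + 3) (hy : 1 / θ ^ 2 ≤ 1024 * x ^ m) :
    Real.log (2 / (θ / 12800)) ≤ 4 * x ^ 2 := by
  have hx0 : 0 < x := by linarith
  have h1 : 2 / (θ / 12800) ≤ x ^ (m + 10) := by
    have h2 : 1 / θ ≤ 1 / θ ^ 2 :=
      one_div_le_one_div_of_le (by positivity) (by nlinarith)
    have h3 : (6 : ℝ) ^ 10 ≤ x ^ 10 := pow_le_pow_left₀ (by norm_num) hx 10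
    have h4 : 2 / (θ / 12800) = 25600 * (1 / θ) := by field_simp; norm_num
    rw [h4, pow_add]
    have h5 : 0 < x ^ m := by positivity
    nlinarith
  refine (Real.log_le_log (by positivity) h1).trans ?_
  rw [Real.log_pow]
  push_cast
  rw [hm]
  have h6 := Real.log_le_self hx0.le
  have h7 : 0 ≤ Real.log x := Real.log_nonneg (by linarith)
  nlinarith

/-- All quantities are bounded by powers of `x`: `1 / θ ^ 2` by `1024 * x ^ (ℓ + 3)` and logarithms
by `4 * x ^ 2`. A round costs order `d * x ^ (ℓ + 5)` samples, and there are order `x ^ (ℓ + 4)`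
rounds. The additive ones come from rounding up. -/
theorem sample_bound {K ε θ x : ℝ} {ℓ d N T S B : ℕ} (hK : 0 < K) (hε : 0 < ε) (hε1 : ε < 1)
    (hℓ : 1 ≤ ℓ) (hd : 1 ≤ d) (hx : x = 6 * ℓ / ε) (hN : 0 < N) (hNx : (N : ℝ) ≤ ℓ * x ^ ℓ)
    (hθ : θ = ε / (32 * Real.sqrt N))
    (hT : (T : ℝ) ≤ K * (d * Real.log (2 / θ) + Real.log (1 / (θ / 12800))) / θ ^ 2 + 1)
    (hS : (S : ℝ) ≤ 128 * Real.log (2 / (θ / 12800)) / θ ^ 2 + 1)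
    (hB : (B : ℝ) ≤ 3200 * ℓ / θ ^ 2 + 1) :
    (B * (T + S) : ℝ) ≤ 3276801 * (8192 * K + 524290) * (d * x ^ (2 * ℓ + 9)) := by
  have hℓ' : (1 : ℝ) ≤ ℓ := by exact_mod_cast hℓ
  have hd' : (1 : ℝ) ≤ d := by exact_mod_cast hd
  have hN' : (1 : ℝ) ≤ N := by exact_mod_cast hN
  have hsqrt : 1 ≤ Real.sqrt N := Real.one_le_sqrt.2 hN'
  have hθ0 : 0 < θ := by rw [hθ]; positivity
  have hθ1 : θ < 1 := by
    rw [hθ, div_lt_one (by positivity)]; linarith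
  have hεx : 1 / ε ≤ x := by
    rw [hx]; exact div_le_div_of_nonneg_right (by linarith) hε.le
  have h6x : 6 * ℓ ≤ x := by
    rw [hx, le_div_iff₀ hε]; nlinarith
  have hx6 : 6 ≤ x := by linarith
  have hx0 : 0 < x := by linarith
  set y := x ^ (ℓ + 3) with hy
  have hy1 : 1 ≤ y := one_le_pow₀ (by linarith)
  have hθy : 1 / θ ^ 2 ≤ 1024 * y := by
    have e : 1 / θ ^ 2 = 1024 * (N * (1 / ε) ^ 2) := by
      rw [hθ, div_pow, mul_pow, Real.sq_sqrt (by linarith)]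
      field_simp
      norm_num
    rw [e]
    refine mul_le_mul_of_nonneg_left ?_ (by norm_num)
    calc (N : ℝ) * (1 / ε) ^ 2 ≤ (x * x ^ ℓ) * x ^ 2 := by
          refine mul_le_mul (hNx.trans (mul_le_mul_of_nonneg_right (by linarith) (by positivity)))
            (pow_le_pow_left₀ (by positivity) hεx 2) (by positivity) (by positivity)
      _ = y := by rw [hy]; ring
  have hΛ : Real.log (2 / (θ / 12800)) ≤ 4 * x ^ 2 :=
    log_two_div_le (ℓ := ℓ) (m := ℓ + 3) hx6 hθ0 hθ1 (by linarith) (by push_cast; ring) hθy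
  have hΛ1 : Real.log (2 / θ) ≤ 4 * x ^ 2 := by
    refine (Real.log_le_log (by positivity) ?_).trans hΛ
    exact div_le_div_of_nonneg_left (by norm_num) (by positivity) (by linarith)
  have hΛ2 : Real.log (1 / (θ / 12800)) ≤ 4 * x ^ 2 := by
    refine (Real.log_le_log (by positivity) ?_).trans hΛ
    exact div_le_div_of_nonneg_right (by norm_num) (by positivity)
  have hx2 : 1 ≤ x ^ 2 := one_le_pow₀ (by linarith)
  have hxy : 1 ≤ x ^ 2 * y := one_le_mul_of_one_le_of_one_le hx2 hy1
  have hdxy : 1 ≤ d * (x ^ 2 * y) := one_le_mul_of_one_le_of_one_le hd' hxy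
  have hθpos : 0 < 1 / θ ^ 2 := by positivity
  have hT' : (T : ℝ) ≤ (8192 * K + 1) * (d * (x ^ 2 * y)) := by
    refine hT.trans ?_
    have h1 : d * Real.log (2 / θ) + Real.log (1 / (θ / 12800)) ≤ 8 * (d * x ^ 2) := by
      have := mul_le_mul_of_nonneg_left hΛ1 (by linarith : (0 : ℝ) ≤ d)
      nlinarith
    have h2 : K * (d * Real.log (2 / θ) + Real.log (1 / (θ / 12800))) / θ ^ 2 ≤
        K * (8 * (d * x ^ 2)) * (1024 * y) := by
      rw [div_eq_mul_one_div]
      refine mul_le_mul (mul_le_mul_of_nonneg_left h1 hK.le) hθy hθpos.le (by positivity)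
    linarith
  have hS' : (S : ℝ) ≤ 524289 * (d * (x ^ 2 * y)) := by
    refine hS.trans ?_
    have h2 : 128 * Real.log (2 / (θ / 12800)) / θ ^ 2 ≤ 128 * (4 * x ^ 2) * (1024 * y) := by
      rw [div_eq_mul_one_div]
      refine mul_le_mul (mul_le_mul_of_nonneg_left hΛ (by norm_num)) hθy hθpos.le (by positivity)
    have h3 : x ^ 2 * y ≤ d * (x ^ 2 * y) := le_mul_of_one_le_left (by positivity) hd'
    linarith
  have hB' : (B : ℝ) ≤ 3276801 * (x * y) := by
    refine hB.trans ?_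
    have h2 : 3200 * ℓ / θ ^ 2 ≤ 3200 * x * (1024 * y) := by
      rw [div_eq_mul_one_div]
      refine mul_le_mul (by linarith) hθy hθpos.le (by positivity)
    have h3 : 1 ≤ x * y := one_le_mul_of_one_le_of_one_le (by linarith) hy1
    linarith
  calc (B * (T + S) : ℝ)
      ≤ 3276801 * (x * y) * ((8192 * K + 524290) * (d * (x ^ 2 * y))) := by
        refine mul_le_mul hB' (by linarith) (by positivity) (by positivity)
    _ = _ := by rw [hy]; ring

theorem le_rpow_sample_bound {A ε x : ℝ} {ℓ d : ℕ} (hA : 9 ≤ A) (hx : x = 6 * ℓ / ε)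
    (hx1 : 1 ≤ x) :
    A * (d * x ^ (2 * ℓ + 9)) ≤ (6 * A * ℓ / ε) ^ (2 * (ℓ : ℝ) + 6 * A) * d := by
  have e : 6 * A * ℓ / ε = A * x := by rw [hx]; ring
  have hAx : 1 ≤ A * x := one_le_mul_of_one_le_of_one_le (by linarith) hx1
  have h1 : (A * x) ^ (2 * ℓ + 9) ≤ (A * x) ^ (2 * (ℓ : ℝ) + 6 * A) := by
    rw [← Real.rpow_natCast]
    refine Real.rpow_le_rpow_of_exponent_le hAx ?_
    push_cast
    linarith
  have h2 : A ≤ A ^ (2 * ℓ + 9) := le_self_pow₀ (by linarith) (by omega)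
  rw [e]
  calc A * (d * x ^ (2 * ℓ + 9)) = (A * x ^ (2 * ℓ + 9)) * d := by ring
    _ ≤ (A * x) ^ (2 * ℓ + 9) * d := by
        rw [mul_pow]
        exact mul_le_mul_of_nonneg_right (mul_le_mul_of_nonneg_right h2 (by positivity))
          (Nat.cast_nonneg d)
    _ ≤ _ := mul_le_mul_of_nonneg_right h1 (Nat.cast_nonneg d)

/-- The algorithm for the nontrivial accuracies. -/
theorem exists_boosting_algorithm {K : ℝ} (hK : 0 < K) (X : Type u) (O : Type v) [Fintype X]
    [Fintype O] [Nonempty O] {d : ℕ} {ε : ℝ} (hd : 1 ≤ d) (hε : 0 < ε) (hε1 : ε < 1) :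
    ∃ (G : Finset (PMF O)) (round : PMF O → G) (alg : Algorithm X O G) (n : ℕ),
      IsDiscretization G round ∧
      (n : ℝ) ≤ 3276801 * (8192 * K + 524290) *
        (d * (6 * Fintype.card O / ε) ^ (2 * Fintype.card O + 9)) ∧
      alg.UsesAtMost n ∧
      ∀ C : Finset (X → Bool), vc C = d → ∀ W : Learner X, StandardLearner K C W →
        ∀ D : PMF (X × O),
          (9 / 10 : ℝ) ≤ pr (alg.run round W D) {p | MultiCalibrated C ε D p} := by
  set ℓ := Fintype.card O with hℓdef
  have hℓ : 1 ≤ ℓ := Fintype.card_pos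
  have hℓ' : (1 : ℝ) ≤ ℓ := by exact_mod_cast hℓ
  -- Makes the rounding error `2 * ℓ / M` at most `ε / 2`, while `M + 1` stays below `6 * ℓ / ε`.
  set M := ⌈4 * ℓ / ε⌉₊ with hM
  have hM0 : 0 < M := Nat.ceil_pos.2 (by positivity)
  have hM0' : (0 : ℝ) < M := by exact_mod_cast hM0
  obtain ⟨G, round, hdisc, hcard, hround⟩ := exists_discretization (O := O) hM0
  have hround' : ∀ f : PMF O, ∑ o, |(f o).toReal - ((round f : PMF O) o).toReal| ≤ ε / 2 := by
    refine fun f => (hround f).trans ?_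
    have h : 4 * ℓ / ε ≤ M := Nat.le_ceil _
    rw [div_le_iff₀ hε] at h
    rw [div_le_iff₀ hM0']
    linarith
  set N := Fintype.card (O × G) with hN
  have hN0 : 0 < N := by
    obtain ⟨o⟩ := ‹Nonempty O›
    exact Fintype.card_pos_iff.2 ⟨(o, round (PMF.pure o))⟩
  set x : ℝ := 6 * ℓ / ε with hx
  have hM1 : ((M + 1 : ℕ) : ℝ) ≤ x := by
    have h : (M : ℝ) < 4 * ℓ / ε + 1 := Nat.ceil_lt_add_one (by positivity)
    have h2 : 1 ≤ ℓ / ε := by rw [le_div_iff₀ hε]; linarith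
    rw [hx, mul_div_assoc]
    rw [mul_div_assoc] at h
    push_cast
    linarith
  have hNx : (N : ℝ) ≤ ℓ * x ^ ℓ := by
    rw [hN, Fintype.card_prod, Fintype.card_coe]
    push_cast
    refine mul_le_mul_of_nonneg_left ?_ (Nat.cast_nonneg _)
    calc (G.card : ℝ) ≤ ((M + 1) ^ ℓ : ℕ) := Nat.cast_le.2 hcard
      _ = ((M + 1 : ℕ) : ℝ) ^ ℓ := by push_cast; ring
      _ ≤ x ^ ℓ := pow_le_pow_left₀ (Nat.cast_nonneg _) hM1 ℓ
  have hN0' : (1 : ℝ) ≤ N := by exact_mod_cast hN0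
  set θ := ε / (32 * Real.sqrt N) with hθ
  have hsqrt : 1 ≤ Real.sqrt N := Real.one_le_sqrt.2 hN0'
  have hθ0 : 0 < θ := by rw [hθ]; positivity
  have hθ1 : θ < 1 := by rw [hθ, div_lt_one (by positivity)]; linarith
  set β := θ / 12800 with hβ
  have hβ0 : 0 < β := by positivity
  have hβ1 : β < 1 := by rw [hβ]; linarith
  set T := ⌈K * (d * Real.log (2 / θ) + Real.log (1 / β)) / θ ^ 2⌉₊ with hT
  -- The deviation exponent at accuracy `θ / 4` is `S * θ ^ 2 / 128`, so the constant function `1`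
  -- is misjudged with probability at most `β`.
  set S := ⌈128 * Real.log (2 / β) / θ ^ 2⌉₊ with hS
  set B := ⌈3200 * ℓ / θ ^ 2⌉₊ with hB
  have hB0 : 0 < B := Nat.ceil_pos.2 (by positivity)
  have hl1 : 0 ≤ Real.log (2 / θ) :=
    Real.log_nonneg (by rw [le_div_iff₀ hθ0]; linarith)
  have hl2 : 0 ≤ Real.log (1 / β) :=
    Real.log_nonneg (by rw [le_div_iff₀ hβ0]; linarith)
  have hl3 : 0 ≤ Real.log (2 / β) :=
    Real.log_nonneg (by rw [le_div_iff₀ hβ0]; linarith)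
  refine ⟨G, round, boostRandomly round θ T S B hB0, B * (T + S), hdisc, ?_,
    usesAtMost_boostRandomly round θ T S B hB0, ?_⟩
  · push_cast
    exact sample_bound hK hε hε1 hℓ hd hx hN0 hNx hθ
      (Nat.ceil_lt_add_one (by positivity)).le (Nat.ceil_lt_add_one (by positivity)).le
      (Nat.ceil_lt_add_one (by positivity)).le
  · intro C hC W hW D
    refine boostRandomly_spec hε hround' hθ0 hθ1 hθ hβ (fun p E => ?_) ?_ hB0 (Nat.le_ceil _)
    · refine hW.2 _ (fun z hz => labeled_support hz) θ β T hθ0 hθ1 hβ0 hβ1 ?_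
      rw [hC]
      exact Nat.le_ceil _
    · have h1 : 128 * Real.log (2 / β) / θ ^ 2 ≤ S := Nat.le_ceil _
      rw [div_le_iff₀ (by positivity)] at h1
      have h2 : Real.exp (-(S * (θ / 4) ^ 2 / 8)) ≤ Real.exp (-Real.log (2 / β)) :=
        Real.exp_le_exp.2 (by linarith)
      rw [Real.exp_neg (Real.log _), Real.exp_log (by positivity), inv_div] at h2
      linarith

/-- At accuracy at least `1` every predictor is multi-calibrated. -/
theorem exists_trivial_algorithm (X : Type u) (O : Type v) [Fintype O] [Nonempty O] {ε : ℝ}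
    (hε : 1 ≤ ε) :
    ∃ (G : Finset (PMF O)) (round : PMF O → G) (alg : Algorithm X O G),
      IsDiscretization G round ∧ alg.UsesAtMost 0 ∧
      ∀ (C : Finset (X → Bool)) (W : Learner X) (D : PMF (X × O)),
        (9 / 10 : ℝ) ≤ pr (alg.run round W D) {p | MultiCalibrated C ε D p} := by
  obtain ⟨G, round, hdisc, -, -⟩ := exists_discretization (O := O) one_pos
  refine ⟨G, round, .output fun _ => softmax fun _ => 0, hdisc, trivial, fun C W D => ?_⟩
  have h : ∀ p : X → PMF O, MultiCalibrated C ε D p := fun p c _ =>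
    (statDist_le_one _ _).trans hε
  rw [Algorithm.run, pr, PMF.toOuterMeasure_pure_apply,
    if_pos (show _ ∈ {p : X → PMF O | MultiCalibrated C ε D p} from h _), ENNReal.toReal_one]
  norm_num

end MultiCal

theorem mainTheorem11 :
    -- Weak agnostic learners of standard sample complexity exist for every class.
    (∃ K : ℝ, 0 < K ∧ ∀ (X : Type*) [Fintype X] (C : Finset (X → Bool)), 1 ≤ MultiCal.vc C →
      ∃ W : MultiCal.Learner X, MultiCal.StandardLearner K C W) ∧
    -- Any such learner suffices for multi-calibration.
    (∀ K : ℝ, 0 < K → ∃ c : ℝ, 0 < c ∧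
      ∀ (X : Type*) (O : Type*) [Fintype X] [Fintype O] [Nonempty O] (d : ℕ) (ε : ℝ),
        1 ≤ d → 0 < ε →
        ∃ (G : Finset (PMF O)) (round : PMF O → G) (alg : MultiCal.Algorithm X O G) (n : ℕ),
          MultiCal.IsDiscretization G round ∧
          (n : ℝ) ≤ (c * Fintype.card O / ε) ^ (2 * (Fintype.card O : ℝ) + c) * d ∧
          alg.UsesAtMost n ∧
          ∀ C : Finset (X → Bool), MultiCal.vc C = d →
            ∀ W : MultiCal.Learner X, MultiCal.StandardLearner K C W →
              ∀ D : PMF (X × O),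
                (9 / 10 : ℝ) ≤ MultiCal.pr (alg.run round W D)
                  {p | MultiCal.MultiCalibrated C ε D p}) := by
  refine ⟨⟨2048, by norm_num, fun X _ C hC =>
    ⟨_, MultiCal.standardLearner_empiricalLearner hC⟩⟩, fun K hK =>
    ⟨6 * (3276801 * (8192 * K + 524290)), by positivity, fun X O _ _ _ d ε hd hε => ?_⟩⟩
  rcases lt_or_ge ε 1 with hε1 | hε1
  · obtain ⟨G, round, alg, n, hdisc, hn, huse, hspec⟩ :=
      MultiCal.exists_boosting_algorithm hK X O hd hε hε1
    refine ⟨G, round, alg, n, hdisc, hn.trans ?_, huse, hspec⟩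
    refine MultiCal.le_rpow_sample_bound (by linarith) rfl ?_
    have hℓ : (1 : ℝ) ≤ Fintype.card O := by exact_mod_cast Fintype.card_pos (α := O)
    rw [le_div_iff₀ hε]
    linarith
  · obtain ⟨G, round, alg, hdisc, huse, hspec⟩ := MultiCal.exists_trivial_algorithm X O hε1
    refine ⟨G, round, alg, 0, hdisc, ?_, huse, fun C _ W _ D => hspec C W D⟩
    rw [Nat.cast_zero]
    positivity
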